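/- Let $V_n$ be the rational symplectic vector space with basis $p_1,\dots,p_n,q_1,\dots,q_n$ and $\omega(p_i,q_i)=1=-\omega(q_i,p_i)$ (all other pairs $0$), and let $\mathfrak a_n^+=\bigoplus_{i\ge 1}(V_n^{\otimes(i+2)})^{\mathbb Z/(i+2)}$ be the Lie algebra of positive-degree symplectic derivations; the bracket of $x\in V_n^{\otimes(i+2)}$ and $y\in V_n^{\otimes (j+2)}$ is the sum of all cyclic rotations of the contraction, by $\omega$, of the first factor of $x$ with the first factor of $y$ in $x\otimes y$. Let $\mathfrak a^+_\infty=\varinjlim\mathfrak a_n^+$, and let $\mathfrak{sp}$ be the degree $0$ part $\varinjlim (V_n^{\otimes 2})^{\mathbb Z/2}$, which acts on $\mathfrak a^+_\infty$ by derivations. *Morita's class.* Let $\mathfrak b_n=\bigwedge^2V_n/\mathbb Q\,\omega_0$, $\omega_0=\sum_i p_i\wedge q_i$ (an abelian Lie algebra), let $\pi_n:\mathfrak a_n^+\to\mathfrak b_n$ be induced by $h_1\otimes h_2\otimes h_3\otimes h_4\mapsto\omega(h_1,h_3)\,h_2\wedge h_4$ (and $0$ on tensors of other lengths). For $n\ge1$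 the quotient map identifies $\ker(\omega:\bigwedge^2V_n\to\mathbb Q)$ with $\mathfrak b_n$; let $\pi_\infty:\mathfrak a_\infty^+\to\mathfrak b_\infty=\varinjlim\mathfrak b_n$ be the limit, where the limit is along the inclusions of these kernels, so that $\mathfrak b_\infty=\ker(\omega:\bigwedge^2V_\infty\to\mathbb Q)$ with $V_\infty=\bigcup_n V_n$. Let $\xi_k$ be the alternating $k$-form on $\mathfrak b_\infty$ induced by the product of contractions $C_{2,3}C_{4,5}\cdots C_{2k-2,2k-1}C_{2k,1}:V_n^{\otimes 2k}\to\mathbb Q$, where $\bigwedge^2V_n\subset V_n^{\otimes2}$ via $a\wedge b\mapsto a\otimes b-b\otimes a$ and $\bigwedge^kU\subset U^{\otimes k}$ via $x_1\wedge\dots\wedge x_k\mapsto\sum_\sigma\operatorname{sgn}(\sigma)\,x_{\sigma(1)}\otimes\dots\otimes x_{\sigma(k)}$. *The ribbon graph class.* Let $\overline{\mathcal{OG}}[k]$ be the rational vector space spanned by oriented (not necessarily connected) ribbon graphs with $k$ vertices, all of valency $\ge3$, modulo isomorphism and $(X,-\mathrm{or})=-(X,\mathrm{or})$; an orientation is an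 ordering of the vertices and a direction of each edge, up to an even number of vertex swaps and edge reversals. Let $\psi_\infty:\bigwedge^k\mathfrak a^+_\infty\to\overline{\mathcal{OG}}[k]$ be Kontsevich's map: identify cyclic invariants with cyclic coinvariants (spiders) by the inverse of $[v_1\otimes\dots\otimes v_m]\mapsto$ (sum of its $m$ rotations), and send a wedge product of $k$ spiders to the sum, over all ways of gluing their legs in pairs, of the product of the contractions $\omega(\text{label of initial leg},\text{label of terminal leg})$ times the glued graph, whose vertices are the spiders in the given order. Let $X_k$ be the oriented ribbon graph with vertices $0,\dots,k-1$, each of valency $4$, in which consecutive vertices are joined cyclically by edges to a $k$-gon and each vertex carries a loop whose two ends separate the two polygon edges in the cyclic order at the vertex. Let $\Theta_k$ be the characteristic function of $X_k$: it is $1$ on $X_k$, $-1$ on $-X_k$, and $0$ on all other ribbon graphs. **Proposition.** Let $k\equiv1\pmod 4$, $k\ne1$. Then $\xi_k$ is well defined: its pullback to $\bigwedge^k\mathfrak b_n$ is, for every $n$, the form that the above contraction on $\bigwedge^k(\bigwedge^2V_n)$ induces on the quotient. There is a sign $\varepsilon\in\{1,-1\}$ such that $$(\pi_\infty)^*\xi_k=\varepsilon\cdot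 k\,2^{k+1}\cdot(\psi_\infty)^*\Theta_k$$ as Chevalley–Eilenberg $k$-cochains on $\mathfrak a^+_\infty$. Both sides are cocycles, and their cohomology classes lie in $PH^k(\mathfrak a^+_\infty)^{\mathfrak{sp}}_{2k}$, the space of primitive, $\mathfrak{sp}$-invariant classes of weight $2k$ in $H^k(\mathfrak a^+_\infty;\mathbb Q)$; so the same identity holds between these classes. In other words, after normalisation of $\xi_k$ by the constant $k2^{k+1}$, Morita's class equals $\pm(\psi_\infty)^*_{2k}(\Theta_k)$. (A class is primitive if its pullback under the map $\mathfrak a^+_\infty\oplus\mathfrak a^+_\infty\to\mathfrak a^+_\infty$ induced by a symplectic embedding $V_\infty\oplus V_\infty\to V_\infty$ is the sum of its pullbacks under the two projections.) -/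

import Mathlib

noncomputable section

namespace Ribbon

open Finset Equiv

/-! ### The symplectic vector spaces and their tensor powers

`ι = Fin n` gives `V_n`, and `ι = ℕ` gives the union `V_∞` of the `V_n`. -/

/-- Basis letters: `Sum.inl i` is `p_i` and `Sum.inr i` is `q_i`. -/
abbrev Letter (ι : Type) := ι ⊕ ι

/-- The symplectic form on basis vectors: `ω(p_i, q_i) = 1 = -ω(q_i, p_i)`, and `0` otherwise. -/
def om {ι : Type} [DecidableEq ι] : Letter ι → Letter ι → ℚ
  | .inl i, .inr j => if i = j then 1 else 0
  | .inr i, .inl j => if i = j then -1 else 0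
  | _, _ => 0

/-- The symplectic vector space with basis `p_i, q_i`, `i : ι`. -/
abbrev V (ι : Type) := Letter ι →₀ ℚ

/-- `⨁_m V^{⊗ m}`: the tensor `v_1 ⊗ ⋯ ⊗ v_m` of basis vectors is the basis element indexed by
the word `[v_1, …, v_m]`. -/
abbrev Tens (ι : Type) := List (Letter ι) →₀ ℚ

/-- The generator of the cyclic groups: `v_1 ⊗ v_2 ⊗ ⋯ ⊗ v_m ↦ v_2 ⊗ ⋯ ⊗ v_m ⊗ v_1`. -/
def rotL (ι : Type) : Tens ι →ₗ[ℚ] Tens ι := Finsupp.lmapDomain ℚ ℚ (fun l => l.rotate 1)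

/-- `⨁_{m ∈ P} (V^{⊗ m})^{ℤ/m}`. -/
def cyc (ι : Type) (P : Set ℕ) : Submodule ℚ (Tens ι) :=
  Finsupp.supported ℚ ℚ {l | l.length ∈ P} ⊓ LinearMap.eqLocus (rotL ι) LinearMap.id

/-- `𝔞⁺ = ⨁_{i ≥ 1} (V^{⊗ (i+2)})^{ℤ/(i+2)}`, the part of positive degree. -/
abbrev aPlus (ι : Type) := cyc ι {m | 3 ≤ m}

/-- The degree `0` part `(V^{⊗ 2})^{ℤ/2} = 𝔰𝔭`. -/
abbrev spPart (ι : Type) := cyc ι {2}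

/-- `C_{1,i+3}` applied to the tensor product of two words, followed by the sum over the cyclic
group, which takes values in the cyclic invariants. -/
def wordBracket {ι : Type} [DecidableEq ι] : List (Letter ι) → List (Letter ι) → Tens ι
  | a :: w, b :: u => om a b • ∑ s ∈ range (w ++ u).length, Finsupp.single ((w ++ u).rotate s) 1
  | _, _ => 0

/-- The bilinear extension of `wordBracket`. On cyclic invariants it is the bracket of
derivations. -/
def tensBracket (ι : Type) [DecidableEq ι] : Tens ι →ₗ[ℚ] Tens ι →ₗ[ℚ] Tens ι :=
  Finsupp.linearCombination ℚ fun w => Finsupp.linearCombination ℚ fun u => wordBracket w u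

theorem sum_rotate_mem {ι : Type} (l : List (Letter ι)) (P : Set ℕ) (h : l.length ∈ P) :
    (∑ s ∈ range l.length, Finsupp.single (l.rotate s) (1 : ℚ)) ∈ cyc ι P := by
  refine ⟨Submodule.sum_mem _ fun s _ => Finsupp.single_mem_supported ℚ _ (by simpa using h), ?_⟩
  change rotL ι _ = _
  rw [map_sum]
  simp only [rotL, Finsupp.lmapDomain_apply, Finsupp.mapDomain_single, List.rotate_rotate]
  have h1 := Finset.sum_range_succ (fun s => Finsupp.single (l.rotate s) (1 : ℚ)) l.length
  have h2 := Finset.sum_range_succ' (fun s => Finsupp.single (l.rotate s) (1 : ℚ)) l.length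
  simp only [List.rotate_length, List.rotate_zero] at h1 h2
  exact add_right_cancel (h2.symm.trans h1)

theorem tensBracket_mem {ι : Type} [DecidableEq ι] {P Q : Set ℕ} (hP : ∀ m ∈ P, 2 ≤ m)
    (hQ : ∀ m ∈ Q, 3 ≤ m) {x y : Tens ι} (hx : x ∈ cyc ι P) (hy : y ∈ cyc ι Q) :
    tensBracket ι x y ∈ aPlus ι := by
  simp only [tensBracket, Finsupp.linearCombination_apply, Finsupp.sum]
  rw [LinearMap.sum_apply]
  refine Submodule.sum_mem _ fun w hw => ?_
  rw [LinearMap.smul_apply]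
  refine Submodule.smul_mem _ _ ?_
  rw [Finsupp.linearCombination_apply]
  refine Submodule.sum_mem _ fun u hu => Submodule.smul_mem _ _ ?_
  have h1 := hP _ ((Finsupp.mem_supported ℚ _).1 hx.1 hw)
  have h2 := hQ _ ((Finsupp.mem_supported ℚ _).1 hy.1 hu)
  cases w with
  | nil => simp at h1
  | cons a w =>
    cases u with
    | nil => simp at h2
    | cons b u =>
      refine Submodule.smul_mem _ _ (sum_rotate_mem _ _ ?_)
      simp at h1 h2 ⊢
      omega

/-- The bracket `𝔞_P × 𝔞_Q → 𝔞⁺`. -/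
def cycBracket {ι : Type} [DecidableEq ι] {P Q : Set ℕ} (hP : ∀ m ∈ P, 2 ≤ m)
    (hQ : ∀ m ∈ Q, 3 ≤ m) : cyc ι P →ₗ[ℚ] cyc ι Q →ₗ[ℚ] aPlus ι :=
  LinearMap.mk₂ ℚ (fun x y => ⟨tensBracket ι x.1 y.1, tensBracket_mem hP hQ x.2 y.2⟩)
    (fun x x' y => Subtype.ext (by simp)) (fun c x y => Subtype.ext (by simp))
    (fun x y y' => Subtype.ext (by simp)) (fun c x y => Subtype.ext (by simp))

/-- The Lie bracket of `𝔞⁺`. -/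
def aBracket (ι : Type) [DecidableEq ι] : aPlus ι →ₗ[ℚ] aPlus ι →ₗ[ℚ] aPlus ι :=
  cycBracket (fun _ h => le_trans (by norm_num) (Set.mem_ofPred_eq ▸ h)) (fun _ h => h)

/-- The action of `𝔰𝔭` on `𝔞⁺` by derivations. -/
def spAct (ι : Type) [DecidableEq ι] : spPart ι →ₗ[ℚ] aPlus ι →ₗ[ℚ] aPlus ι :=
  cycBracket (fun _ h => le_of_eq (Set.mem_singleton_iff.1 h).symm) (fun _ h => h)

/-- The map of tensors induced by renaming the indices of basis vectors along `f`. -/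
def tensMap {ι κ : Type} (f : ι → κ) : Tens ι →ₗ[ℚ] Tens κ :=
  Finsupp.lmapDomain ℚ ℚ (List.map (Sum.map f f))

theorem tensMap_mem {ι κ : Type} (f : ι → κ) {P : Set ℕ} {x : Tens ι} (hx : x ∈ cyc ι P) :
    tensMap f x ∈ cyc κ P := by
  constructor
  · classical
    rw [SetLike.mem_coe, Finsupp.mem_supported]
    intro l hl
    obtain ⟨l', h', rfl⟩ := Finset.mem_image.1 (Finsupp.mapDomain_support hl)
    have := (Finsupp.mem_supported ℚ _).1 hx.1 h'
    simpa using this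
  · have h : rotL ι x = x := hx.2
    change rotL κ (tensMap f x) = tensMap f x
    conv_rhs => rw [← h]
    simp only [rotL, tensMap, Finsupp.lmapDomain_apply, ← Finsupp.mapDomain_comp]
    congr 1
    funext l
    simp [List.map_rotate]

/-- The map `𝔞⁺_ι → 𝔞⁺_κ` induced by `f : ι → κ`. -/
def aMap {ι κ : Type} (f : ι → κ) : aPlus ι →ₗ[ℚ] aPlus κ :=
  (tensMap f).restrict fun _ hx => tensMap_mem f hx

/-! ### Lie algebra cohomology -/

section Cohomology

variable {L : Type} [AddCommGroup L] [Module ℚ L]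

/-- Chevalley–Eilenberg cochains `Hom(⋀^k L, ℚ)`. -/
abbrev Cochain (L : Type) [AddCommGroup L] [Module ℚ L] (k : ℕ) := L [⋀^Fin k]→ₗ[ℚ] ℚ

/-- The Chevalley–Eilenberg differential with trivial coefficients
`(dc)(x_0, …, x_k) = ∑_{i<l} (-1)^{i+l} c([x_i, x_l], x_0, …, x̂_i, …, x̂_l, …, x_k)`,
where `l = j + 1`, as a function on sequences. -/
def ceD (br : L →ₗ[ℚ] L →ₗ[ℚ] L) : (k : ℕ) → Cochain L k →ₗ[ℚ] ((Fin (k + 1) → L) → ℚ)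
  | 0 => 0
  | k + 1 =>
    { toFun := fun c x => ∑ i : Fin (k + 2), ∑ j : Fin (k + 1),
        if (i : ℕ) ≤ j then
          (-1 : ℚ) ^ ((i : ℕ) + (j + 1)) *
            c (Fin.cons (br (x i) (x j.succ)) fun t => x (i.succAbove (j.succAbove t)))
        else 0
      map_add' := fun c c' => by
        funext x
        simp only [AlternatingMap.add_apply, Pi.add_apply, ← Finset.sum_add_distrib]
        refine Finset.sum_congr rfl fun i _ => Finset.sum_congr rfl fun j _ => ?_
        split_ifs
        · ring
        · simp
      map_smul' := fun r c => by
        funext x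
        simp only [AlternatingMap.smul_apply, Pi.smul_apply, RingHom.id_apply, smul_eq_mul,
          Finset.mul_sum]
        refine Finset.sum_congr rfl fun i _ => Finset.sum_congr rfl fun j _ => ?_
        split_ifs
        · ring
        · simp }

/-- Cocycles. -/
def cocycles (br : L →ₗ[ℚ] L →ₗ[ℚ] L) (k : ℕ) : Submodule ℚ (Cochain L k) :=
  LinearMap.ker (ceD br k)

/-- Coboundaries, as functions on sequences. -/
def coboundaries (br : L →ₗ[ℚ] L →ₗ[ℚ] L) : (k : ℕ) → Submodule ℚ ((Fin k → L) → ℚ)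
  | 0 => ⊥
  | k + 1 => LinearMap.range (ceD br k)

/-- A cochain as a function on sequences. -/
def toFn (L : Type) [AddCommGroup L] [Module ℚ L] (k : ℕ) :
    Cochain L k →ₗ[ℚ] ((Fin k → L) → ℚ) where
  toFun c := c
  map_add' _ _ := rfl
  map_smul' _ _ := rfl

/-- `H^k(L; ℚ)`: cocycles modulo coboundaries. -/
abbrev Coh (br : L →ₗ[ℚ] L →ₗ[ℚ] L) (k : ℕ) :=
  cocycles br k ⧸ ((coboundaries br k).comap (toFn L k)).comap (cocycles br k).subtype

/-- The cohomology class of a cocycle. -/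
def Coh.mk (br : L →ₗ[ℚ] L →ₗ[ℚ] L) (k : ℕ) : cocycles br k →ₗ[ℚ] Coh br k :=
  Submodule.mkQ _

/-- The bracket of the direct sum `L ⊕ L`. -/
def prodBracket (br : L →ₗ[ℚ] L →ₗ[ℚ] L) : L × L →ₗ[ℚ] L × L →ₗ[ℚ] L × L :=
  LinearMap.mk₂ ℚ (fun x y => (br x.1 y.1, br x.2 y.2))
    (fun x x' y => by simp) (fun c x y => by simp)
    (fun x y y' => by simp) (fun c x y => by simp)

end Cohomology

/-! ### The subspace `PH^k(𝔞⁺_∞)^{𝔰𝔭}_{w}` of primitive, `𝔰𝔭`-invariant classes of weight `w` -/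

/-- Cochains of weight `w`: those vanishing on products of homogeneous elements whose degrees
do not add up to `w`; words of length `d + 2` have degree `d`. -/
def weightCochains (k w : ℕ) : Submodule ℚ (Cochain (aPlus ℕ) k) where
  carrier := {c | ∀ (x : Fin k → aPlus ℕ) (d : Fin k → ℕ),
    (∀ j, (x j).1 ∈ cyc ℕ {d j + 2}) → ∑ j, d j ≠ w → c x = 0}
  add_mem' {a b} ha hb x d h hd := by simp [ha x d h hd, hb x d h hd]
  zero_mem' x d h hd := by simp
  smul_mem' r {c} hc x d h hd := by simp [hc x d h hd]

/-- Up to sign, the Lie derivative of a cochain along `X ∈ 𝔰𝔭`. -/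
def lieDer (k : ℕ) (X : spPart ℕ) :
    Cochain (aPlus ℕ) k →ₗ[ℚ] ((Fin k → aPlus ℕ) → ℚ) where
  toFun c x := ∑ i, c (Function.update x i (spAct ℕ X (x i)))
  map_add' c c' := by funext x; simp [Finset.sum_add_distrib]
  map_smul' r c := by funext x; simp [Finset.mul_sum]

/-- The sum map `𝔞⁺_∞ ⊕ 𝔞⁺_∞ → 𝔞⁺_∞` given by a symplectic embedding `V_∞ ⊕ V_∞ → V_∞` (even and
odd indices). It induces the coproduct of the Hopf algebra. -/
def sumMap : aPlus ℕ × aPlus ℕ →ₗ[ℚ] aPlus ℕ :=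
  (aMap fun i => 2 * i).coprod (aMap fun i => 2 * i + 1)

/-- `μ^* c - pr_1^* c - pr_2^* c` for the sum map `μ`. A class is primitive, i.e. its coproduct is
`c ⊗ 1 + 1 ⊗ c`, when this is a coboundary. -/
def primDefect (k : ℕ) :
    Cochain (aPlus ℕ) k →ₗ[ℚ] ((Fin k → aPlus ℕ × aPlus ℕ) → ℚ) where
  toFun c x := c (fun i => sumMap (x i)) - c (fun i => (x i).1) - c (fun i => (x i).2)
  map_add' c c' := by funext x; simp; ring
  map_smul' r c := by funext x; simp; ring

/-- `H^k(𝔞⁺_∞; ℚ)`. -/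
abbrev HA (k : ℕ) := Coh (aBracket ℕ) k

/-- `PH^k(𝔞⁺_∞)^{𝔰𝔭}_w`. -/
def PHsp (k w : ℕ) : Submodule ℚ (HA k) :=
  ((weightCochains k w ⊓
      (⨅ X : spPart ℕ, (coboundaries (aBracket ℕ) k).comap (lieDer k X)) ⊓
      (coboundaries (prodBracket (aBracket ℕ)) k).comap (primDefect k)).comap
    (cocycles (aBracket ℕ) k).subtype).map (Coh.mk (aBracket ℕ) k)

/-! ### The abelian quotients -/

/-- Basis vectors. -/
abbrev ev {ι : Type} (s : Letter ι) : V ι := Finsupp.single s 1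

/-- `⋀² V` as a subspace of `V^{⊗ 2}`, via `a ∧ b ↦ a ⊗ b - b ⊗ a`; the right-hand side is
`V^{⊗ 2}` in coordinates. -/
def wedgeToTens (ι : Type) [DecidableEq ι] :
    ⋀[ℚ]^2 (V ι) →ₗ[ℚ] ((Fin 2 → Letter ι) →₀ ℚ) :=
  PiTensorProduct.ofFinsuppEquiv'.toLinearMap ∘ₗ exteriorPower.toTensorPower ℚ (V ι) 2

/-- The contraction `C_{1,2}` restricted to `⋀² V`. -/
def contr (ι : Type) [DecidableEq ι] : ⋀[ℚ]^2 (V ι) →ₗ[ℚ] ℚ :=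
  Finsupp.linearCombination ℚ (fun w : Fin 2 → Letter ι => om (w 0) (w 1)) ∘ₗ wedgeToTens ι

/-- The symplectic element `ω_0 = ∑ p_i ∧ q_i`. -/
def omega0 (n : ℕ) : ⋀[ℚ]^2 (V (Fin n)) :=
  ∑ i : Fin n, exteriorPower.ιMulti ℚ 2 ![ev (.inl i), ev (.inr i)]

/-- `𝔟_n = ⋀² V_n / ℚ ω_0`. -/
abbrev bFin (n : ℕ) := ⋀[ℚ]^2 (V (Fin n)) ⧸ Submodule.span ℚ {omega0 n}

/-- The map `h_1 ⊗ h_2 ⊗ h_3 ⊗ h_4 ↦ ω(h_1, h_3) h_2 ∧ h_4` on words of length four, and `0` on the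
other words. -/
def wordContr {ι : Type} [DecidableEq ι] : List (Letter ι) → ⋀[ℚ]^2 (V ι)
  | [h₁, h₂, h₃, h₄] => om h₁ h₃ • exteriorPower.ιMulti ℚ 2 ![ev h₂, ev h₄]
  | _ => 0

/-- The linear extension of `wordContr`. -/
def tensContr (ι : Type) [DecidableEq ι] : Tens ι →ₗ[ℚ] ⋀[ℚ]^2 (V ι) :=
  Finsupp.linearCombination ℚ wordContr

/-- `π_n : 𝔞⁺_n → 𝔟_n`. -/
def piFin (n : ℕ) : aPlus (Fin n) →ₗ[ℚ] bFin n :=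
  Submodule.mkQ _ ∘ₗ tensContr (Fin n) ∘ₗ (aPlus (Fin n)).subtype

theorem om_symm {ι : Type} [DecidableEq ι] (s t : Letter ι) : om s t = - om t s := by
  rcases s with i | i <;> rcases t with j | j <;> simp [om, eq_comm] <;> split_ifs <;> simp

theorem wedgeToTens_apply {ι : Type} [DecidableEq ι] (v : Fin 2 → V ι) (p : Fin 2 → Letter ι) :
    wedgeToTens ι (exteriorPower.ιMulti ℚ 2 v) p =
      v 0 (p 0) * v 1 (p 1) - v 1 (p 0) * v 0 (p 1) := by
  have h : ∀ u : Fin 2 → V ι, (PiTensorProduct.ofFinsuppEquiv' (PiTensorProduct.tprod ℚ u) :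
      (Fin 2 → Letter ι) →₀ ℚ) p = u 0 (p 0) * u 1 (p 1) := by
    intro u
    rw [PiTensorProduct.ofFinsuppEquiv'_apply_apply, Fin.prod_univ_two]
  have huniv : (Finset.univ : Finset (Equiv.Perm (Fin 2))) = {1, Equiv.swap 0 1} := by decide
  have key : exteriorPower.toTensorPower ℚ (V ι) 2 (exteriorPower.ιMulti ℚ 2 v) =
      PiTensorProduct.tprod ℚ v - PiTensorProduct.tprod ℚ (fun i => v (Equiv.swap 0 1 i)) := by
    rw [exteriorPower.toTensorPower_apply_ιMulti, huniv, Finset.sum_pair (by decide),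
      Equiv.Perm.sign_one, one_smul, Equiv.Perm.sign_swap (by decide), Units.neg_smul, one_smul,
      sub_eq_add_neg]
    rfl
  rw [wedgeToTens, LinearMap.comp_apply, key, map_sub, Finsupp.sub_apply]
  exact congrArg₂ _ (h _) (h _)

theorem wedgeToTens_e {ι : Type} [DecidableEq ι] (s t : Letter ι) :
    wedgeToTens ι (exteriorPower.ιMulti ℚ 2 ![ev s, ev t]) =
      Finsupp.single ![s, t] 1 - Finsupp.single ![t, s] 1 := by
  ext p
  have h : ∀ s t : Letter ι, (Finsupp.single ![s, t] (1 : ℚ)) p =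
      Finsupp.single s 1 (p 0) * Finsupp.single t 1 (p 1) := by
    intro s t
    have : (![s, t] = p) ↔ (s = p 0 ∧ t = p 1) := by
      rw [funext_iff, Fin.forall_fin_two]; rfl
    simp only [Finsupp.single_apply, this]
    split_ifs <;> simp_all
  rw [wedgeToTens_apply, Finsupp.sub_apply, h, h]
  rfl

theorem contr_wedge {ι : Type} [DecidableEq ι] (s t : Letter ι) :
    contr ι (exteriorPower.ιMulti ℚ 2 ![ev s, ev t]) = 2 * om s t := by
  rw [contr, LinearMap.comp_apply, wedgeToTens_e, map_sub, Finsupp.linearCombination_single,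
    Finsupp.linearCombination_single]
  simp only [Matrix.cons_val_zero, Matrix.cons_val_one, one_smul]
  rw [om_symm t s]
  ring

theorem contr_omega0 (n : ℕ) : contr (Fin n) (omega0 n) = 2 * n := by
  simp [omega0, contr_wedge, om, mul_comm]

/-- The map `⋀² V_ι → ⋀² V_κ` induced by renaming indices. -/
def wedgeMap {ι κ : Type} (f : ι → κ) : ⋀[ℚ]^2 (V ι) →ₗ[ℚ] ⋀[ℚ]^2 (V κ) :=
  exteriorPower.map 2 (Finsupp.lmapDomain ℚ ℚ (Sum.map f f))

theorem wedgeMap_ev {ι κ : Type} (f : ι → κ) (s t : Letter ι) :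
    wedgeMap f (exteriorPower.ιMulti ℚ 2 ![ev s, ev t]) =
      exteriorPower.ιMulti ℚ 2 ![ev (Sum.map f f s), ev (Sum.map f f t)] := by
  rw [wedgeMap, exteriorPower.map_apply_ιMulti]
  congr 1
  funext i
  fin_cases i <;> simp

theorem wedge_ext {ι : Type} {N : Type*} [AddCommGroup N] [Module ℚ N]
    {f g : ⋀[ℚ]^2 (V ι) →ₗ[ℚ] N}
    (h : ∀ s t : Letter ι, f (exteriorPower.ιMulti ℚ 2 ![ev s, ev t]) =
      g (exteriorPower.ιMulti ℚ 2 ![ev s, ev t])) : f = g := by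
  refine exteriorPower.linearMap_ext ?_
  refine Module.Basis.ext_alternating (Finsupp.basisSingleOne (R := ℚ) (ι := Letter ι)) fun v _ => ?_
  have : (fun i => Finsupp.basisSingleOne (R := ℚ) (v i)) = ![ev (v 0), ev (v 1)] := by
    funext i
    fin_cases i <;> simp
  rw [this]
  exact h _ _

theorem om_map {ι κ : Type} [DecidableEq ι] [DecidableEq κ] {f : ι → κ}
    (hf : Function.Injective f) (s t : Letter ι) :
    om (Sum.map f f s) (Sum.map f f t) = om s t := by
  rcases s with i | i <;> rcases t with j | j <;> simp [om, hf.eq_iff]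

theorem contr_wedgeMap {ι κ : Type} [DecidableEq ι] [DecidableEq κ] {f : ι → κ}
    (hf : Function.Injective f) (x : ⋀[ℚ]^2 (V ι)) : contr κ (wedgeMap f x) = contr ι x := by
  have : contr κ ∘ₗ wedgeMap f = contr ι := by
    refine wedge_ext fun s t => ?_
    rw [LinearMap.comp_apply, wedgeMap_ev, contr_wedge, contr_wedge, om_map hf]
  exact LinearMap.congr_fun this x

/-- The direct limit `𝔟_∞` of the `𝔟_n` along the maps induced by the inclusions
`𝔞⁺_n ⊆ 𝔞⁺_{n+1}`. The image of `𝔞⁺_n` in `⋀² V_n` lies in the complement `ker C_{1,2}` of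
`ℚ ω_0`, and so the limit is `ker C_{1,2} ⊆ ⋀² V_∞`, the map from `𝔟_n` being
`bToInf n`, `[x] ↦ x - (C_{1,2} x / 2n) ω_0`; see `piInf_aMap`, `bToInf_injective` and `exists_bToInf` below. -/
def bInf : Submodule ℚ (⋀[ℚ]^2 (V ℕ)) := LinearMap.ker (contr ℕ)

/-- The projection of `⋀² V_n` to `ker C_{1,2}` along `ω_0`. -/
def projKer (n : ℕ) : ⋀[ℚ]^2 (V (Fin n)) →ₗ[ℚ] ⋀[ℚ]^2 (V (Fin n)) :=
  LinearMap.id - (contr (Fin n)).smulRight ((2 * (n : ℚ))⁻¹ • omega0 n)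

theorem subsingleton_wedge_zero (x : ⋀[ℚ]^2 (V (Fin 0))) : x = 0 := by
  have : (LinearMap.id : ⋀[ℚ]^2 (V (Fin 0)) →ₗ[ℚ] _) = 0 :=
    wedge_ext fun s _ => by rcases s with i | i <;> exact i.elim0
  exact LinearMap.congr_fun this x

theorem contr_projKer (n : ℕ) (x : ⋀[ℚ]^2 (V (Fin n))) :
    contr (Fin n) (projKer n x) = 0 := by
  rcases Nat.eq_zero_or_pos n with rfl | hn
  · rw [subsingleton_wedge_zero x, map_zero, map_zero]
  · have : (n : ℚ) ≠ 0 := by positivity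
    simp only [projKer, LinearMap.sub_apply, LinearMap.id_apply, LinearMap.smulRight_apply,
      map_sub, map_smul, contr_omega0, smul_eq_mul]
    field_simp
    ring

theorem projKer_omega0 (n : ℕ) : projKer n (omega0 n) = 0 := by
  rcases Nat.eq_zero_or_pos n with rfl | hn
  · exact subsingleton_wedge_zero _
  · have : (n : ℚ) ≠ 0 := by positivity
    simp only [projKer, LinearMap.sub_apply, LinearMap.id_apply, LinearMap.smulRight_apply,
      contr_omega0, smul_smul]
    rw [mul_inv_cancel₀ (by positivity), one_smul, sub_self]

theorem projKer_of_contr {n : ℕ} {x : ⋀[ℚ]^2 (V (Fin n))} (hx : contr (Fin n) x = 0) :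
    projKer n x = x := by
  simp [projKer, hx]

theorem span_omega0_le (n : ℕ) : Submodule.span ℚ {omega0 n} ≤
    LinearMap.ker (wedgeMap (Fin.val : Fin n → ℕ) ∘ₗ projKer n) := by
  refine (Submodule.span_singleton_le_iff_mem _ _).2 (LinearMap.mem_ker.2 ?_)
  rw [LinearMap.comp_apply, projKer_omega0, map_zero]

/-- The projection of `⋀² V_n` to `ker C_{1,2}`, followed by the inclusion into `⋀² V_∞`, on the
quotient `𝔟_n`. -/
def bToWedge (n : ℕ) : bFin n →ₗ[ℚ] ⋀[ℚ]^2 (V ℕ) :=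
  Submodule.liftQ (Submodule.span ℚ {omega0 n}) (wedgeMap Fin.val ∘ₗ projKer n) (span_omega0_le n)

theorem bToWedge_mk (n : ℕ) (x : ⋀[ℚ]^2 (V (Fin n))) :
    bToWedge n (Submodule.Quotient.mk x) = wedgeMap Fin.val (projKer n x) := rfl

theorem bToWedge_mem (n : ℕ) (y : bFin n) : bToWedge n y ∈ bInf := by
  obtain ⟨x, rfl⟩ := Submodule.Quotient.mk_surjective _ y
  rw [bInf, LinearMap.mem_ker, bToWedge_mk, contr_wedgeMap Fin.val_injective, contr_projKer]

/-- The structure map `𝔟_n → 𝔟_∞` of the direct limit. -/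
def bToInf (n : ℕ) : bFin n →ₗ[ℚ] bInf :=
  LinearMap.codRestrict bInf (bToWedge n) (bToWedge_mem n)

theorem bToInf_coe (n : ℕ) (y : bFin n) : (bToInf n y).1 = bToWedge n y := rfl

theorem contr_tensContr {ι : Type} [DecidableEq ι] {x : Tens ι} (hx : rotL ι x = x) :
    contr ι (tensContr ι x) = 0 := by
  have h : ∀ x : Tens ι, contr ι (tensContr ι (rotL ι x)) = - contr ι (tensContr ι x) := by
    intro x
    have : contr ι ∘ₗ tensContr ι ∘ₗ rotL ι = - (contr ι ∘ₗ tensContr ι) := by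
      refine Finsupp.lhom_ext' fun l => LinearMap.ext_ring ?_
      simp only [LinearMap.comp_apply, Finsupp.lsingle_apply, rotL, Finsupp.lmapDomain_apply,
        Finsupp.mapDomain_single, tensContr, Finsupp.linearCombination_single, one_smul,
        LinearMap.neg_apply]
      match l with
      | [] => simp [wordContr]
      | [_] => simp [wordContr]
      | [_, _] => simp [wordContr]
      | [_, _, _] => simp [wordContr]
      | [h₁, h₂, h₃, h₄] =>
        simp only [List.rotate_cons_succ, List.rotate_zero, List.cons_append, List.nil_append,
          wordContr, map_smul, contr_wedge, smul_eq_mul]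
        rw [om_symm h₃ h₁]
        ring
      | _ :: _ :: _ :: _ :: _ :: l => cases l <;> simp [wordContr]
    exact LinearMap.congr_fun this x
  have := h x
  rw [hx] at this
  linarith

/-- `π_∞ : 𝔞⁺_∞ → 𝔟_∞`. -/
def piInf : aPlus ℕ →ₗ[ℚ] bInf :=
  LinearMap.codRestrict bInf (tensContr ℕ ∘ₗ (aPlus ℕ).subtype) fun x => contr_tensContr x.2.2

theorem tensContr_tensMap {ι κ : Type} [DecidableEq ι] [DecidableEq κ] {f : ι → κ}
    (hf : Function.Injective f) (x : Tens ι) :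
    tensContr κ (tensMap f x) = wedgeMap f (tensContr ι x) := by
  have : tensContr κ ∘ₗ tensMap f = wedgeMap f ∘ₗ tensContr ι := by
    refine Finsupp.lhom_ext' fun l => LinearMap.ext_ring ?_
    simp only [LinearMap.comp_apply, Finsupp.lsingle_apply, tensMap, Finsupp.lmapDomain_apply,
      Finsupp.mapDomain_single, tensContr, Finsupp.linearCombination_single, one_smul]
    match l with
    | [] => simp [wordContr]
    | [_] => simp [wordContr]
    | [_, _] => simp [wordContr]
    | [_, _, _] => simp [wordContr]
    | [h₁, h₂, h₃, h₄] =>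
      simp only [List.map_cons, List.map_nil, wordContr, map_smul, wedgeMap_ev, om_map hf]
    | _ :: _ :: _ :: _ :: _ :: l => simp [wordContr]
  exact LinearMap.congr_fun this x

/-- `π_∞` is the limit of the `π_n`. -/
theorem piInf_aMap (n : ℕ) (x : aPlus (Fin n)) :
    piInf (aMap Fin.val x) = bToInf n (piFin n x) := by
  refine Subtype.ext ?_
  have h1 : (piInf (aMap Fin.val x)).1 = tensContr ℕ (tensMap Fin.val x.1) := rfl
  have h2 : (bToInf n (piFin n x)).1 = wedgeMap Fin.val (projKer n (tensContr (Fin n) x.1)) :=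
    bToWedge_mk n _
  rw [h1, h2, tensContr_tensMap Fin.val_injective, projKer_of_contr (contr_tensContr x.2.2)]

theorem bToInf_injective (n : ℕ) : Function.Injective (bToInf n) := by
  refine (injective_iff_map_eq_zero (bToInf n)).2 fun y hy => ?_
  obtain ⟨x, rfl⟩ := Submodule.Quotient.mk_surjective _ y
  have h1 : wedgeMap Fin.val (projKer n x) = 0 := congrArg Subtype.val hy
  have hinj : Function.Injective (wedgeMap (Fin.val : Fin n → ℕ)) := by
    refine exteriorPower.map_injective_field ?_
    exact Finsupp.mapDomain_injective
      (Sum.map_injective.2 ⟨Fin.val_injective, Fin.val_injective⟩)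
  have h2 : projKer n x = 0 := hinj (by rw [h1, map_zero])
  rw [Submodule.Quotient.mk_eq_zero, Submodule.mem_span_singleton]
  refine ⟨contr (Fin n) x * (2 * (n : ℚ))⁻¹, ?_⟩
  have h3 : x - contr (Fin n) x • ((2 * (n : ℚ))⁻¹ • omega0 n) = 0 := h2
  rw [mul_smul]
  exact (sub_eq_zero.1 h3).symm

theorem exists_wedgeMap (x : ⋀[ℚ]^2 (V ℕ)) :
    ∃ N, ∀ n, N ≤ n → ∃ y : ⋀[ℚ]^2 (V (Fin n)), wedgeMap Fin.val y = x := by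
  have key : ∀ x ∈ (⊤ : Submodule ℚ (⋀[ℚ]^2 (V ℕ))),
      ∃ N, ∀ n, N ≤ n → ∃ y : ⋀[ℚ]^2 (V (Fin n)), wedgeMap Fin.val y = x := by
    intro x hx
    have hs : Submodule.span ℚ (Set.range fun s : Letter ℕ => (ev s : V ℕ)) = ⊤ := by
      simpa using (Finsupp.basisSingleOne (R := ℚ) (ι := Letter ℕ)).span_eq
    rw [← exteriorPower.ιMulti_span_of_span ℚ 2 (V ℕ) hs] at hx
    induction hx using Submodule.span_induction with
    | mem x h =>
      obtain ⟨v, hv, rfl⟩ := h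
      obtain ⟨s, hs⟩ := hv (Set.mem_range_self 0)
      obtain ⟨t, ht⟩ := hv (Set.mem_range_self 1)
      have hvv : v = ![ev s, ev t] := by
        funext i
        fin_cases i
        · exact hs.symm
        · exact ht.symm
      have hl : ∀ s : Letter ℕ, ∃ N, ∀ n, N ≤ n → ∃ s' : Letter (Fin n),
          Sum.map Fin.val Fin.val s' = s := by
        rintro (i | i)
        · exact ⟨i + 1, fun n hn => ⟨.inl ⟨i, hn⟩, rfl⟩⟩
        · exact ⟨i + 1, fun n hn => ⟨.inr ⟨i, hn⟩, rfl⟩⟩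
      obtain ⟨N, hN⟩ := hl s
      obtain ⟨M, hM⟩ := hl t
      refine ⟨max N M, fun n hn => ?_⟩
      obtain ⟨s', hs'⟩ := hN n (le_trans (le_max_left _ _) hn)
      obtain ⟨t', ht'⟩ := hM n (le_trans (le_max_right _ _) hn)
      exact ⟨exteriorPower.ιMulti ℚ 2 ![ev s', ev t'], by rw [wedgeMap_ev, hs', ht', hvv]⟩
    | zero => exact ⟨0, fun n _ => ⟨0, map_zero _⟩⟩
    | add x y _ _ hx hy =>
      obtain ⟨N, hN⟩ := hx
      obtain ⟨M, hM⟩ := hy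
      refine ⟨max N M, fun n hn => ?_⟩
      obtain ⟨x', hx'⟩ := hN n (le_trans (le_max_left _ _) hn)
      obtain ⟨y', hy'⟩ := hM n (le_trans (le_max_right _ _) hn)
      exact ⟨x' + y', by rw [map_add, hx', hy']⟩
    | smul r x _ hx =>
      obtain ⟨N, hN⟩ := hx
      refine ⟨N, fun n hn => ?_⟩
      obtain ⟨x', hx'⟩ := hN n hn
      exact ⟨r • x', by rw [map_smul, hx']⟩
  exact key x trivial

/-- `𝔟_∞` is the union of the images of the `𝔟_n`. -/
theorem exists_bToInf (x : bInf) : ∃ n, ∃ y : bFin n, bToInf n y = x := by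
  obtain ⟨N, hN⟩ := exists_wedgeMap x.1
  obtain ⟨y, hy⟩ := hN N le_rfl
  refine ⟨N, Submodule.Quotient.mk y, Subtype.ext ?_⟩
  have h : contr (Fin N) y = 0 := by
    rw [← contr_wedgeMap Fin.val_injective, hy]
    exact x.2
  rw [bToInf_coe, bToWedge_mk, projKer_of_contr h, hy]

/-- The map on `k`-fold tensor products with prescribed values on basis elements, as a
multilinear map. -/
def mlin {k : ℕ} {W : Type} [DecidableEq W] {M : Type*} [AddCommGroup M] [Module ℚ M]
    (f : (Fin k → W) → M) : MultilinearMap ℚ (fun _ : Fin k => W →₀ ℚ) M :=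
  (Finsupp.linearCombination ℚ f ∘ₗ
    (PiTensorProduct.ofFinsuppEquiv' (R := ℚ) (κ := fun _ : Fin k => W)).toLinearMap).compMultilinearMap
      (PiTensorProduct.tprod ℚ)

theorem mlin_single {k : ℕ} {W : Type} [DecidableEq W] {M : Type*} [AddCommGroup M] [Module ℚ M]
    (f : (Fin k → W) → M) (w : Fin k → W) :
    mlin f (fun j => Finsupp.single (w j) 1) = f w := by
  have := PiTensorProduct.ofFinsuppEquiv'_tprod_single (R := ℚ) w (fun _ => 1)
  rw [Finset.prod_const_one] at this
  simp only [mlin, LinearMap.compMultilinearMap_apply, LinearMap.comp_apply,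
    LinearEquiv.coe_coe]
  rw [this]
  simp

/-- The contraction `C_{2,3} C_{4,5} ⋯ C_{2k-2,2k-1} C_{2k,1}` on `(V^{⊗ 2})^{⊗ k} = V^{⊗ 2k}`: on the tensor
`v_1 ⊗ ⋯ ⊗ v_{2k}` whose `j`-th pair is `w j = (v_{2j+1}, v_{2j+2})`, `j = 0, …, k-1`. -/
def polygonContr (ι : Type) [DecidableEq ι] (k : ℕ) :
    MultilinearMap ℚ (fun _ : Fin k => (Fin 2 → Letter ι) →₀ ℚ) ℚ :=
  mlin fun w => ∏ j, om (w j 1) (w (finRotate k j) 0)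

/-- The `k`-gon form on `⋀^k (⋀² V)`: the contraction restricted to `⋀^k (⋀² V)`, which is regarded
as a subspace of `(⋀² V)^{⊗ k} ⊆ V^{⊗ 2k}` via
`x_1 ∧ ⋯ ∧ x_k ↦ ∑_σ sign(σ) x_{σ 1} ⊗ ⋯ ⊗ x_{σ k}`. -/
def polygonForm (ι : Type) [DecidableEq ι] (k : ℕ) : (⋀[ℚ]^2 (V ι)) [⋀^Fin k]→ₗ[ℚ] ℚ :=
  MultilinearMap.alternatization
    ((polygonContr ι k).compLinearMap fun _ => wedgeToTens ι)

/-- The `k`-gon invariant `ξ_k` on `𝔟_∞`. -/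
def xi (k : ℕ) : bInf [⋀^Fin k]→ₗ[ℚ] ℚ := (polygonForm ℕ k).compLinearMap bInf.subtype

/-- The cochain `π_∞^* ξ_k` on `𝔞⁺_∞`. -/
def moritaCochain (k : ℕ) : Cochain (aPlus ℕ) k := (xi k).compLinearMap piInf

/-! ### Ribbon graphs -/

/-- An oriented ribbon graph with `k` vertices, not necessarily connected, all of whose vertices
have valency at least three. -/
structure RibbonGraph (k : ℕ) where
  /-- The half-edges. -/
  H : Type
  [fintypeH : Fintype H]
  [decEqH : DecidableEq H]
  /-- The next half-edge in the cyclic order at a vertex. -/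
  rot : Perm H
  /-- The other half of the edge. -/
  flip : Perm H
  flip_flip : ∀ h, flip (flip h) = h
  flip_ne : ∀ h, flip h ≠ h
  rot_ne : ∀ h, rot h ≠ h
  rot_rot_ne : ∀ h, rot (rot h) ≠ h
  /-- The vertex to which a half-edge is attached; the values in `Fin k` are the vertex order of
  the orientation. -/
  vert : H → Fin k
  vert_surjective : Function.Surjective vert
  vert_eq_iff : ∀ h h', vert h = vert h' ↔ rot.SameCycle h h'
  /-- Whether a half-edge is the initial half of its edge, for the edge directions of the
  orientation. -/
  out : H → Bool
  out_flip : ∀ h, out (flip h) = !out h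

attribute [instance] RibbonGraph.fintypeH RibbonGraph.decEqH

/-- An isomorphism of ribbon graphs, which need not respect the orientations. -/
structure RibbonIso {k : ℕ} (X Y : RibbonGraph k) where
  /-- The bijection of half-edges. -/
  toEquiv : X.H ≃ Y.H
  map_rot : ∀ h, toEquiv (X.rot h) = Y.rot (toEquiv h)
  map_flip : ∀ h, toEquiv (X.flip h) = Y.flip (toEquiv h)
  /-- The permutation of vertices. -/
  perm : Perm (Fin k)
  map_vert : ∀ h, Y.vert (toEquiv h) = perm (X.vert h)

namespace RibbonIso

variable {k : ℕ} {X Y Z : RibbonGraph k}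

/-- `+1` if the isomorphism preserves the orientations and `-1` if it reverses them: the sign of
the vertex permutation times `(-1)` to the number of edges whose direction is reversed. -/
def sgn (φ : RibbonIso X Y) : ℤˣ :=
  Perm.sign φ.perm * ∏ h with X.out h = true, if Y.out (φ.toEquiv h) then 1 else -1

/-- Composition. -/
def trans (φ : RibbonIso X Y) (ψ : RibbonIso Y Z) : RibbonIso X Z where
  toEquiv := φ.toEquiv.trans ψ.toEquiv
  map_rot h := by simp [φ.map_rot, ψ.map_rot]
  map_flip h := by simp [φ.map_flip, ψ.map_flip]
  perm := ψ.perm * φ.perm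
  map_vert h := by simp [φ.map_vert, ψ.map_vert]

/-- Inverse. -/
def symm (φ : RibbonIso X Y) : RibbonIso Y X where
  toEquiv := φ.toEquiv.symm
  map_rot h := by rw [Equiv.symm_apply_eq, φ.map_rot, Equiv.apply_symm_apply]
  map_flip h := by rw [Equiv.symm_apply_eq, φ.map_flip, Equiv.apply_symm_apply]
  perm := φ.perm⁻¹
  map_vert h := by
    rw [Perm.eq_inv_iff_eq, ← φ.map_vert, Equiv.apply_symm_apply]

theorem prod_out (φ : RibbonIso X Y) (F : Y.H → ℤˣ) (hF : ∀ g, F (Y.flip g) = - F g) :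
    ∏ g with Y.out g = true, F g =
      ∏ h with X.out h = true, (if Y.out (φ.toEquiv h) then 1 else -1) * F (φ.toEquiv h) := by
  symm
  refine Finset.prod_bij
    (fun h _ => if Y.out (φ.toEquiv h) then φ.toEquiv h else Y.flip (φ.toEquiv h)) ?_ ?_ ?_ ?_
  · intro h _
    by_cases hh : Y.out (φ.toEquiv h) = true
    · simp [hh]
    · simp [hh, Y.out_flip]
  · intro h hx h' hx' heq
    simp only [Finset.mem_filter, Finset.mem_univ, true_and] at hx hx'
    by_cases hh : Y.out (φ.toEquiv h) = true <;> by_cases hh' : Y.out (φ.toEquiv h') = true <;>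
      simp only [hh, hh', if_true, Bool.false_eq_true, if_false] at heq
    · exact φ.toEquiv.injective heq
    · rw [← φ.map_flip] at heq
      have := φ.toEquiv.injective heq
      rw [this, X.out_flip, hx'] at hx
      simp at hx
    · rw [← φ.map_flip] at heq
      have := φ.toEquiv.injective heq
      rw [← this, X.out_flip, hx] at hx'
      simp at hx'
    · exact φ.toEquiv.injective (Y.flip.injective heq)
  · intro g hg
    simp only [Finset.mem_filter, Finset.mem_univ, true_and] at hg
    by_cases hx : X.out (φ.toEquiv.symm g) = true
    · exact ⟨φ.toEquiv.symm g, by simpa using hx, by simp [hg]⟩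
    · refine ⟨X.flip (φ.toEquiv.symm g), by simp [X.out_flip, hx], ?_⟩
      simp [φ.map_flip, Y.out_flip, hg, Y.flip_flip]
  · intro h _
    by_cases hh : Y.out (φ.toEquiv h) = true
    · simp [hh]
    · simp [hh, hF]

theorem sgn_trans (φ : RibbonIso X Y) (ψ : RibbonIso Y Z) :
    (φ.trans ψ).sgn = φ.sgn * ψ.sgn := by
  have h := φ.prod_out (fun g => if Z.out (ψ.toEquiv g) then (1 : ℤˣ) else -1) (by
    intro g
    rw [ψ.map_flip, Z.out_flip]
    by_cases hh : Z.out (ψ.toEquiv g) = true <;> simp [hh])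
  rw [sgn, sgn, sgn, h, Finset.prod_mul_distrib]
  set A := ∏ h with X.out h = true, if Y.out (φ.toEquiv h) then (1 : ℤˣ) else -1
  set B := ∏ h with X.out h = true, if Z.out (ψ.toEquiv (φ.toEquiv h)) then (1 : ℤˣ) else -1 with hB
  have h1 : (∏ h with X.out h = true, if Z.out ((φ.trans ψ).toEquiv h) then (1 : ℤˣ) else -1) = B := rfl
  have h2 : (φ.trans ψ).perm = ψ.perm * φ.perm := rfl
  rw [h1, h2, Perm.sign_mul]
  calc _ = Perm.sign φ.perm * (A * A) * Perm.sign ψ.perm * B := by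
        rw [Int.units_mul_self, mul_one, mul_comm (Perm.sign ψ.perm)]
    _ = _ := by simp only [mul_assoc, mul_comm, mul_left_comm]

theorem sgn_symm (φ : RibbonIso X Y) : φ.symm.sgn = φ.sgn := by
  have h : (φ.trans φ.symm).sgn = 1 := by
    have h1 : (φ.trans φ.symm).perm = 1 := inv_mul_cancel _
    have h2 : ∀ h, (φ.trans φ.symm).toEquiv h = h := fun h => φ.toEquiv.symm_apply_apply h
    rw [sgn, h1, Perm.sign_one, one_mul]
    refine Finset.prod_eq_one fun h hh => ?_
    simp only [Finset.mem_filter, Finset.mem_univ, true_and] at hh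
    simp [h2, hh]
  rw [sgn_trans] at h
  rw [← mul_one φ.sgn, ← Int.units_mul_self φ.symm.sgn, ← mul_assoc, h, one_mul]

end RibbonIso

/-- The span of the relations `X = ± Y` for an isomorphism `X ≅ Y` that preserves (`+`) or
reverses (`-`) the orientations. In particular `(X, -or) = -(X, or)`. -/
def graphRel (k : ℕ) : Submodule ℚ (RibbonGraph k →₀ ℚ) :=
  Submodule.span ℚ {x | ∃ (X Y : RibbonGraph k) (φ : RibbonIso X Y),
    x = Finsupp.single X 1 - ((φ.sgn : ℤ) : ℚ) • Finsupp.single Y 1}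

/-- The space of oriented graphs with `k` vertices of the reduced associative graph complex. -/
abbrev OG (k : ℕ) := (RibbonGraph k →₀ ℚ) ⧸ graphRel k

/-- The class of an oriented ribbon graph. -/
def OG.mk {k : ℕ} (X : RibbonGraph k) : OG k :=
  Submodule.Quotient.mk (Finsupp.single X 1)

theorem OG.mk_eq {k : ℕ} {X Y : RibbonGraph k} (φ : RibbonIso X Y) :
    OG.mk X = ((φ.sgn : ℤ) : ℚ) • OG.mk Y := by
  rw [OG.mk, OG.mk, ← Submodule.Quotient.mk_smul, Submodule.Quotient.eq]
  exact Submodule.subset_span ⟨X, Y, φ, rfl⟩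

open Classical in
/-- The characteristic function of `X` on oriented ribbon graphs: it is `1` on graphs isomorphic to
`X` and `-1` on graphs isomorphic to `X` with the opposite orientation (so it is `0` if `X = -X`),
and `0` on all other graphs. -/
def charFun {k : ℕ} (X Y : RibbonGraph k) : ℚ :=
  (if ∃ φ : RibbonIso X Y, φ.sgn = 1 then 1 else 0) -
    (if ∃ φ : RibbonIso X Y, φ.sgn = -1 then 1 else 0)

theorem charFun_iso {k : ℕ} (X : RibbonGraph k) {Y Z : RibbonGraph k} (ψ : RibbonIso Y Z) :
    charFun X Y = ((ψ.sgn : ℤ) : ℚ) * charFun X Z := by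
  have key : ∀ s : ℤˣ, (∃ φ : RibbonIso X Y, φ.sgn = s) ↔
      ∃ φ : RibbonIso X Z, φ.sgn = s * ψ.sgn := by
    intro s
    constructor
    · rintro ⟨φ, hφ⟩
      exact ⟨φ.trans ψ, by rw [RibbonIso.sgn_trans, hφ]⟩
    · rintro ⟨φ, hφ⟩
      refine ⟨φ.trans ψ.symm, ?_⟩
      rw [RibbonIso.sgn_trans, hφ, RibbonIso.sgn_symm, mul_assoc, Int.units_mul_self, mul_one]
  classical
  rw [charFun, charFun, if_congr (key 1) rfl rfl, if_congr (key (-1)) rfl rfl]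
  rcases Int.units_eq_one_or ψ.sgn with h | h <;> simp [h]

/-- The characteristic function of an oriented ribbon graph as a functional on graphs. -/
def charMap {k : ℕ} (X : RibbonGraph k) : OG k →ₗ[ℚ] ℚ :=
  Submodule.liftQ (graphRel k) (Finsupp.linearCombination ℚ (charFun X)) (by
    rw [graphRel, Submodule.span_le]
    rintro x ⟨Y, Z, φ, rfl⟩
    simp [charFun_iso X φ])

/-- The cyclic order at the vertices of `X_k`. -/
def polygonRot (k : ℕ) : Perm (Fin k × Fin 4) :=
  Equiv.prodCongr (Equiv.refl (Fin k)) (Equiv.addRight (1 : Fin 4))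

theorem polygonRot_apply (k : ℕ) (i : Fin k) (a : Fin 4) : polygonRot k (i, a) = (i, a + 1) := rfl

theorem polygonRot_sameCycle {k : ℕ} (h h' : Fin k × Fin 4) :
    h.1 = h'.1 ↔ (polygonRot k).SameCycle h h' := by
  have hn : ∀ (n : ℕ) (i : Fin k) (a : Fin 4), (polygonRot k ^ n) (i, a) = (i, a + n • 1) := by
    intro n
    induction n with
    | zero => intro i a; simp
    | succ n ih =>
      intro i a
      rw [pow_succ, Perm.mul_apply, polygonRot_apply, ih, succ_nsmul', add_assoc]
  constructor
  · obtain ⟨i, a⟩ := h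
    obtain ⟨i', a'⟩ := h'
    rintro (rfl : i = i')
    refine ⟨((a' - a : Fin 4) : ℕ), ?_⟩
    have : ∀ a a' : Fin 4, a + ((a' - a : Fin 4) : ℕ) • 1 = a' := by decide
    rw [zpow_natCast, hn, this]
  · intro hc
    obtain ⟨n, hn'⟩ := hc.exists_nat_pow_eq
    obtain ⟨i, a⟩ := h
    rw [hn] at hn'
    rw [← hn']

/-- The edges of `X_k`. -/
def polygonFlip {k : ℕ} : Fin k × Fin 4 → Fin k × Fin 4
  | (i, 0) => ((finRotate k).symm i, 2)
  | (i, 1) => (i, 3)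
  | (i, 2) => (finRotate k i, 0)
  | (i, 3) => (i, 1)

theorem polygonFlip_flip {k : ℕ} (h : Fin k × Fin 4) : polygonFlip (polygonFlip h) = h := by
  obtain ⟨i, a⟩ := h
  fin_cases a
  · exact Prod.ext (Equiv.apply_symm_apply _ _) rfl
  · rfl
  · exact Prod.ext (Equiv.symm_apply_apply _ _) rfl
  · rfl

/-- The ribbon graph `X_k`: the vertices `0, …, k-1` are joined to a `k`-gon by the edges from
`(i, 2)` to `(i+1, 0)`, and every vertex `i` carries a loop from `(i, 1)` to `(i, 3)`. Here `(i, 0)`,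
`(i, 1)`, `(i, 2)`, `(i, 3)` are the half-edges at `i` in their cyclic order, so that the ends of
the loop separate the two edges of the polygon. -/
def polygonGraph (k : ℕ) : RibbonGraph k where
  H := Fin k × Fin 4
  rot := polygonRot k
  flip := ⟨polygonFlip, polygonFlip, polygonFlip_flip, polygonFlip_flip⟩
  flip_flip := polygonFlip_flip
  flip_ne h := by
    obtain ⟨i, a⟩ := h
    fin_cases a <;> simp [polygonFlip]
  rot_ne h := by
    obtain ⟨i, a⟩ := h
    fin_cases a <;> simp [polygonRot_apply]
  rot_rot_ne h := by
    obtain ⟨i, a⟩ := h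
    fin_cases a <;> simp [polygonRot_apply]
  vert := Prod.fst
  vert_surjective i := ⟨(i, 0), rfl⟩
  vert_eq_iff := polygonRot_sameCycle
  out h := h.2 = 1 ∨ h.2 = 2
  out_flip h := by
    obtain ⟨i, a⟩ := h
    fin_cases a <;> simp [polygonFlip]

/-- `Θ_k`, the characteristic function of `X_k`. -/
def Theta (k : ℕ) : OG k →ₗ[ℚ] ℚ := charMap (polygonGraph k)

/-! ### The map `ψ` from `⋀ 𝔞⁺` to graphs -/

section Psi

variable {ι : Type} {k : ℕ}

/-- The legs of the `k` spiders whose legs carry the letters of the words `w 0, …, w (k-1)`. -/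
abbrev Leg (w : Fin k → List (Letter ι)) := Σ j : Fin k, Fin (w j).length

/-- The letter at a leg. -/
def label (w : Fin k → List (Letter ι)) (h : Leg w) : Letter ι := (w h.1).get h.2

/-- The cyclic order of the legs of each spider. -/
def legRot (w : Fin k → List (Letter ι)) : Perm (Leg w) :=
  Equiv.sigmaCongrRight fun j => finRotate (w j).length

/-- A pairing of the elements of `L` with a choice of direction for each pair. -/
abbrev Gluing (L : Type) :=
  {p : Perm L × (L → Bool) // (∀ h, p.1 (p.1 h) = h) ∧ ∀ h, p.2 (p.1 h) = !p.2 h}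

theorem legRot_sameCycle (w : Fin k → List (Letter ι)) (h h' : Leg w) :
    h.1 = h'.1 ↔ (legRot w).SameCycle h h' := by
  have hn : ∀ (n : ℕ) (j : Fin k) (a : Fin (w j).length),
      ((legRot w) ^ n) ⟨j, a⟩ = ⟨j, ((finRotate (w j).length) ^ n) a⟩ := by
    intro n
    induction n with
    | zero => intro j a; simp
    | succ n ih =>
      intro j a
      rw [pow_succ, Perm.mul_apply]
      have : legRot w ⟨j, a⟩ = ⟨j, finRotate (w j).length a⟩ := rfl
      rw [this, ih, pow_succ, Perm.mul_apply]
  constructor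
  · obtain ⟨j, a⟩ := h
    obtain ⟨j', a'⟩ := h'
    rintro (rfl : j = j')
    have hex : ∃ n : ℕ, ((finRotate (w j).length) ^ n) a = a' := by
      rcases lt_or_ge (w j).length 2 with hl | hl
      · refine ⟨0, Fin.ext ?_⟩
        have := a.2
        have := a'.2
        simp
        omega
      · obtain ⟨m, hm⟩ := Nat.exists_eq_add_of_le' hl
        have hc : ∀ a a' : Fin (w j).length, finRotate (w j).length a ≠ a := by
          rw [hm]
          intro a _
          have := support_finRotate (n := m)
          have ha : a ∈ (finRotate (m + 2)).support := by rw [this]; simp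
          exact Perm.mem_support.1 ha
        have hcyc : (finRotate (w j).length).IsCycle := by rw [hm]; exact isCycle_finRotate
        exact (hcyc.sameCycle (hc a a) (hc a' a')).exists_nat_pow_eq
    obtain ⟨n, hn'⟩ := hex
    exact ⟨n, by rw [zpow_natCast, hn, hn']⟩
  · intro hc
    obtain ⟨n, hn'⟩ := hc.exists_nat_pow_eq
    obtain ⟨j, a⟩ := h
    rw [hn] at hn'
    rw [← hn']

theorem finRotate_ne {m : ℕ} (hm : 3 ≤ m) (a : Fin m) :
    finRotate m a ≠ a ∧ finRotate m (finRotate m a) ≠ a := by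
  obtain ⟨n, rfl⟩ := Nat.exists_eq_add_of_le' hm
  rw [finRotate_apply, finRotate_apply, add_assoc]
  constructor <;> intro h <;> have h' := congrArg Fin.val (add_eq_left.1 h) <;>
    simp [Fin.val_add, Nat.mod_eq_of_lt] at h'

/-- The oriented ribbon graph obtained by gluing legs: the spiders become the vertices, in the given
order, and the pairs of legs become the edges. -/
def glue (w : Fin k → List (Letter ι)) (hw : ∀ j, 3 ≤ (w j).length) (p : Gluing (Leg w)) :
    RibbonGraph k where
  H := Leg w
  rot := legRot w
  flip := p.1.1
  flip_flip := p.2.1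
  flip_ne h := fun hh => by
    have := p.2.2 h
    rw [hh] at this
    simp at this
  rot_ne h := by
    obtain ⟨j, a⟩ := h
    intro hh
    have : (⟨j, finRotate _ a⟩ : Leg w) = ⟨j, a⟩ := hh
    exact (finRotate_ne (hw j) a).1 (by simpa using this)
  rot_rot_ne h := by
    obtain ⟨j, a⟩ := h
    intro hh
    have : (⟨j, finRotate _ (finRotate _ a)⟩ : Leg w) = ⟨j, a⟩ := hh
    exact (finRotate_ne (hw j) a).2 (by simpa using this)
  vert := Sigma.fst
  vert_surjective j := ⟨⟨j, ⟨0, lt_of_lt_of_le (by norm_num) (hw j)⟩⟩, rfl⟩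
  vert_eq_iff := legRot_sameCycle w
  out := p.1.2
  out_flip := p.2.2

variable [DecidableEq ι]

/-- The product of the contractions `ω(initial leg, terminal leg)` over the glued pairs. -/
def glueCoeff (w : Fin k → List (Letter ι)) (p : Gluing (Leg w)) : ℚ :=
  ∏ h with p.1.2 h = true, om (label w h) (label w (p.1.1 h))

/-- The value of `ψ` on the wedge product of `k` spiders: the sum over all ways of gluing the legs in
pairs of the product of the contractions of the labels times the glued graph. Reversing the
direction of an edge changes the sign of both factors, so the summand depends on the pairing
alone; instead of choosing directions, the sum is over all directed pairings, and it is divided by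
the number `2^(number of pairs)` of directions of a pairing. -/
def spiderGlue (w : Fin k → List (Letter ι)) : OG k :=
  if hw : ∀ j, 3 ≤ (w j).length then
    (1 / 2 : ℚ) ^ (Fintype.card (Leg w) / 2) •
      ∑ p : Gluing (Leg w), glueCoeff w p • OG.mk (glue w hw p)
  else 0

theorem spiderGlue_perm (w : Fin k → List (Letter ι)) (s : Perm (Fin k)) :
    spiderGlue (fun j => w (s j)) = ((Perm.sign s : ℤ) : ℚ) • spiderGlue w := by
  by_cases hw : ∀ j, 3 ≤ (w j).length
  · have hw' : ∀ j, 3 ≤ (w (s j)).length := fun j => hw (s j)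
    rw [spiderGlue, spiderGlue, dif_pos hw, dif_pos hw']
    let e : Leg (fun j => w (s j)) ≃ Leg w :=
      Equiv.sigmaCongrLeft (β := fun j => Fin (w j).length) s
    let E : Gluing (Leg fun j => w (s j)) ≃ Gluing (Leg w) :=
      (Equiv.prodCongr (Equiv.permCongr e) (Equiv.arrowCongr e (Equiv.refl Bool))).subtypeEquiv
        (fun p => by
          constructor
          · rintro ⟨h1, h2⟩
            exact ⟨fun h => by simp [Equiv.permCongr_apply, h1],
              fun h => by simp [Equiv.permCongr_apply, h2]⟩
          · rintro ⟨h1, h2⟩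
            refine ⟨fun h => ?_, fun h => ?_⟩
            · have := h1 (e h)
              simpa [Equiv.permCongr_apply] using this
            · have := h2 (e h)
              simpa [Equiv.permCongr_apply] using this)
    have hE1 : ∀ p h, (E p).1.1 (e h) = e (p.1.1 h) := by
      intro p h
      simp [E, Equiv.permCongr_apply]
    have hE2 : ∀ p h, (E p).1.2 (e h) = p.1.2 h := by
      intro p h
      simp [E]
    have hlab : ∀ h, label w (e h) = label (fun j => w (s j)) h := fun h => rfl
    have hcard : Fintype.card (Leg fun j => w (s j)) = Fintype.card (Leg w) :=
      Fintype.card_congr e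
    have hcoeff : ∀ p, glueCoeff w (E p) = glueCoeff (fun j => w (s j)) p := by
      intro p
      symm
      refine Finset.prod_equiv e (fun h => ?_) (fun h _ => ?_)
      · simp [hE2]
      · rw [hE1, hlab, hlab]
    have hgraph : ∀ p, OG.mk (glue (fun j => w (s j)) hw' p) =
        ((Perm.sign s : ℤ) : ℚ) • OG.mk (glue w hw (E p)) := by
      intro p
      let φ : RibbonIso (glue (fun j => w (s j)) hw' p) (glue w hw (E p)) :=
        { toEquiv := e
          map_rot := fun h => rfl
          map_flip := fun h => (hE1 p h).symm
          perm := s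
          map_vert := fun h => rfl }
      have hs : φ.sgn = Perm.sign s := by
        rw [RibbonIso.sgn, Finset.prod_eq_one, mul_one]
        intro h hh
        have h1 : p.1.2 h = true := (Finset.mem_filter.1 hh).2
        have h2 : (E p).1.2 (e h) = true := (hE2 p h).trans h1
        exact if_pos h2
      rw [OG.mk_eq φ, hs]
    rw [hcard, smul_comm (((Perm.sign s : ℤ) : ℚ))]
    refine congrArg _ ?_
    rw [Finset.smul_sum, ← E.sum_comp]
    refine Finset.sum_congr rfl fun p _ => ?_
    rw [hcoeff, hgraph, smul_comm]
  · have hw' : ¬ ∀ j, 3 ≤ (w (s j)).length := fun h => hw fun j => by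
      simpa using h (s.symm j)
    rw [spiderGlue, spiderGlue, dif_neg hw, dif_neg hw', smul_zero]

/-- `ψ` on cyclically invariant tensors, extended to all tensors. The identification of the cyclic
invariants with the cyclic coinvariants (spiders) is inverse to
`[v_1 ⊗ ⋯ ⊗ v_m] ↦ ∑ (cyclic rotations of v_1 ⊗ ⋯ ⊗ v_m)`; it sends an invariant tensor of length `m`
to `1/m` times its class. -/
def psiTens (ι : Type) [DecidableEq ι] (k : ℕ) :
    MultilinearMap ℚ (fun _ : Fin k => Tens ι) (OG k) :=
  mlin fun w => (∏ j, ((w j).length : ℚ)⁻¹) • spiderGlue w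

theorem psiTens_perm (s : Perm (Fin k)) (x : Fin k → Tens ι) :
    psiTens ι k (fun j => x (s j)) = ((Perm.sign s : ℤ) : ℚ) • psiTens ι k x := by
  have h : (psiTens ι k).domDomCongr s = ((Perm.sign s : ℤ) : ℚ) • psiTens ι k := by
    refine Module.Basis.ext_multilinear
      (fun _ => Finsupp.basisSingleOne (R := ℚ) (ι := List (Letter ι))) fun w => ?_
    simp only [Finsupp.coe_basisSingleOne, MultilinearMap.domDomCongr_apply,
      smul_apply]
    rw [psiTens, mlin_single, mlin_single _ w, spiderGlue_perm, smul_comm]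
    congr 2
    exact Equiv.prod_comp s fun j => ((w j).length : ℚ)⁻¹
  exact congrArg (fun f => f x) h

/-- `ψ : ⋀^k 𝔞⁺ → OG`. -/
def psi (ι : Type) [DecidableEq ι] (k : ℕ) : (aPlus ι) [⋀^Fin k]→ₗ[ℚ] OG k where
  toMultilinearMap := (psiTens ι k).compLinearMap fun _ => (aPlus ι).subtype
  map_eq_zero_of_eq' := fun x i j hij hne => by
    have h := psiTens_perm (Equiv.swap i j) fun l => (x l).1
    have hx : (fun l => (x (Equiv.swap i j l)).1) = fun l => (x l).1 := by
      funext l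
      rcases eq_or_ne l i with rfl | h1
      · rw [Equiv.swap_apply_left, hij]
      · rcases eq_or_ne l j with rfl | h2
        · rw [Equiv.swap_apply_right, hij]
        · rw [Equiv.swap_apply_of_ne_of_ne h1 h2]
    rw [hx, Perm.sign_swap hne] at h
    have h2 : psiTens ι k (fun l => (x l).1) + psiTens ι k (fun l => (x l).1) = 0 := by
      nth_rewrite 1 [h]
      simp
    rw [← two_smul ℚ] at h2
    exact (smul_eq_zero.1 h2).resolve_left (by norm_num)

end Psi

/-- The cochain `ψ_∞^* Θ_k` on `𝔞⁺_∞`. -/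
def kontsevichCochain (k : ℕ) : Cochain (aPlus ℕ) k :=
  (Theta k).compAlternatingMap (psi ℕ k)

end Ribbon

end

noncomputable section

namespace Ribbon

open Finset Equiv

/-! ### The contraction along a polygon -/

/-! Both cochains are the same sum over ways of placing words of length four around a polygon,
counted with different multiplicities. Call `cut` the map sending `[a, b, c, d]` to `ω(b, d) a ⊗ c`,
and `cutForm` the alternating form that cuts its arguments and contracts the results along a
`k`-gon.

On a cyclically invariant tensor, Morita's contraction into `⋀² V ⊆ V ⊗ V` is `-2` times the cut
(`wedgeToTens_tensContr`), so his cochain is `(-2)^k * cutForm`. On the graph side, `Θ_k` of a sum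
of gluings picks out the gluings isomorphic to `X_k`. An isomorphism from `X_k` to a glued graph
amounts to a permutation of the spiders and a rotation of each, and its contribution, sign included,
is a term of `cutForm` at rotated words. Each gluing is met `|Aut X_k| = 2k` times. All these
automorphisms preserve the orientation because `k ≡ 1 mod 4`, so nothing cancels (`card_polygonAut`,
`sgn_aut_polygonGraph`, `Theta_spiderGlue`). The `4^k` rotations cancel the factors `1/4` in `ψ`, so
`cutForm` is `2k` times the ribbon cochain. As `k` is odd, `(-2)^k * 2k = -k * 2^(k+1)`, and the
sign is `-1`.

The remaining assertions are proved for Morita's cochain and transferred by this proportionality.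
The form descends to the quotient because inserting `ω_0` in a `k`-gon leaves a `(k-1)`-gon up to
sign, and rotating its even number of sides is an odd permutation (`polygonForm_eq_zero_of_omega0`).
The cocycle condition holds because `π_∞` kills brackets (`tensContr_tensBracket`). Invariance under
`𝔰𝔭` is the invariance of `ω` applied at every side (`polygonContr_actSnd`), and primitivity is the
connectedness of the polygon (`polygonContr_add`). Weight, invariance and primitivity already hold
at the level of cochains, with no coboundary correction. -/

/-- `V ⊗ V` in coordinates. -/
abbrev Pairs (ι : Type) := (Fin 2 → Letter ι) →₀ ℚ

theorem multilinear_ext_single {k : ℕ} {W M : Type*} [AddCommGroup M] [Module ℚ M]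
    {f g : MultilinearMap ℚ (fun _ : Fin k => W →₀ ℚ) M}
    (h : ∀ w : Fin k → W, f (fun j => Finsupp.single (w j) 1) =
      g (fun j => Finsupp.single (w j) 1)) : f = g := by
  refine Module.Basis.ext_multilinear
    (fun _ => Finsupp.basisSingleOne (R := ℚ) (ι := W)) fun w => ?_
  simpa using h w

theorem polygonContr_single {ι : Type} [DecidableEq ι] {k : ℕ} (w : Fin k → Fin 2 → Letter ι) :
    polygonContr ι k (fun j => Finsupp.single (w j) 1) =
      ∏ j, om (w j 1) (w (finRotate k j) 0) := mlin_single _ _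

/-- Rotation only permutes the sides of the polygon. This symmetry produces the cancellation that
makes `ω_0` a null vector of the polygon form. -/
theorem polygonContr_rotate {ι : Type} [DecidableEq ι] {k : ℕ} (y : Fin k → Pairs ι) :
    polygonContr ι k (fun j => y (finRotate k j)) = polygonContr ι k y := by
  have h : (polygonContr ι k).domDomCongr (finRotate k) = polygonContr ι k := by
    refine multilinear_ext_single fun w => ?_
    rw [MultilinearMap.domDomCongr_apply, polygonContr_single fun j => w (finRotate k j),
      polygonContr_single]
    exact Equiv.prod_comp (finRotate k) fun j => om (w j 1) (w (finRotate k j) 0)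
  exact congrArg (fun f => f y) h

theorem polygonContr_rotate_pow {ι : Type} [DecidableEq ι] {k : ℕ} (n : ℕ) (y : Fin k → Pairs ι) :
    polygonContr ι k (fun j => y ((finRotate k ^ n) j)) = polygonContr ι k y := by
  induction n with
  | zero => rfl
  | succ n ih =>
    rw [← ih]
    exact polygonContr_rotate fun j => y ((finRotate k ^ n) j)

/-- The map `V_ι ⊗ V_ι → V_κ ⊗ V_κ` induced by renaming indices. -/
def pairsMap {ι κ : Type} (f : ι → κ) : Pairs ι →ₗ[ℚ] Pairs κ :=
  Finsupp.lmapDomain ℚ ℚ (fun w => Sum.map f f ∘ w)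

theorem pairsMap_single {ι κ : Type} (f : ι → κ) (w : Fin 2 → Letter ι) (c : ℚ) :
    pairsMap f (Finsupp.single w c) = Finsupp.single (Sum.map f f ∘ w) c := by
  simp [pairsMap]

theorem polygonContr_pairsMap {ι κ : Type} [DecidableEq ι] [DecidableEq κ] {f : ι → κ}
    (hf : Function.Injective f) {k : ℕ} (y : Fin k → Pairs ι) :
    polygonContr κ k (fun j => pairsMap f (y j)) = polygonContr ι k y := by
  have h : (polygonContr κ k).compLinearMap (fun _ => pairsMap f) = polygonContr ι k := by
    refine multilinear_ext_single fun w => ?_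
    rw [MultilinearMap.compLinearMap_apply]
    simp only [pairsMap_single]
    rw [polygonContr_single, polygonContr_single]
    simp [om_map hf]
  exact congrArg (fun f => f y) h

theorem wedgeToTens_wedgeMap {ι κ : Type} [DecidableEq ι] [DecidableEq κ] (f : ι → κ)
    (x : ⋀[ℚ]^2 (V ι)) : wedgeToTens κ (wedgeMap f x) = pairsMap f (wedgeToTens ι x) := by
  have hc : ∀ s t : Letter ι, Sum.map f f ∘ ![s, t] = ![Sum.map f f s, Sum.map f f t] := by
    intro s t
    funext i
    fin_cases i <;> rfl
  have h : wedgeToTens κ ∘ₗ wedgeMap f = pairsMap f ∘ₗ wedgeToTens ι := by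
    refine wedge_ext fun s t => ?_
    rw [LinearMap.comp_apply, LinearMap.comp_apply, wedgeMap_ev, wedgeToTens_e, wedgeToTens_e,
      map_sub, pairsMap_single, pairsMap_single, hc, hc]
  exact LinearMap.congr_fun h x

theorem polygonForm_apply {ι : Type} [DecidableEq ι] {k : ℕ} (x : Fin k → ⋀[ℚ]^2 (V ι)) :
    polygonForm ι k x =
      ∑ s : Perm (Fin k), Perm.sign s • polygonContr ι k fun j => wedgeToTens ι (x (s j)) := by
  rw [polygonForm, MultilinearMap.alternatization_apply]
  rfl

theorem polygonForm_wedgeMap {ι κ : Type} [DecidableEq ι] [DecidableEq κ] {f : ι → κ}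
    (hf : Function.Injective f) {k : ℕ} (x : Fin k → ⋀[ℚ]^2 (V ι)) :
    polygonForm κ k (fun j => wedgeMap f (x j)) = polygonForm ι k x := by
  rw [polygonForm_apply, polygonForm_apply]
  simp only [wedgeToTens_wedgeMap, polygonContr_pairsMap hf]

/-! ### The polygon form descends to the quotient by the symplectic element -/

/-- Contracting both factors of the symplectic element with the neighbouring factors contracts the
neighbours with each other. -/
theorem sum_om_omega0 {n : ℕ} (a b : Letter (Fin n)) :
    ∑ i : Fin n, (om a (.inl i) * om (.inr i) b - om a (.inr i) * om (.inl i) b) = - om a b := by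
  rcases a with a | a <;> rcases b with b | b <;> simp [om]

/-- As a tensor, `ω_0` is inverse to `ω` up to sign, so the vertex carrying it can be deleted and
its two neighbours contracted directly; the polygon loses one side. -/
theorem polygonContr_cons_omega0 {n k : ℕ} (z : Fin (k + 1) → Pairs (Fin n)) :
    polygonContr (Fin n) (k + 2)
      (Fin.cons (α := fun _ => Pairs (Fin n)) (wedgeToTens (Fin n) (omega0 n)) z) =
        - polygonContr (Fin n) (k + 1) z := by
  have h : (polygonContr (Fin n) (k + 2)).curryLeft (wedgeToTens (Fin n) (omega0 n)) =
      - polygonContr (Fin n) (k + 1) := by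
    refine multilinear_ext_single fun w => ?_
    -- Isolates the two contractions that meet position `0`; the other sides do not depend on `p`.
    have hs : ∀ p : Fin 2 → Letter (Fin n),
        (polygonContr (Fin n) (k + 2)).curryLeft (Finsupp.single p 1)
          (fun j => Finsupp.single (w j) 1) =
        om (p 1) (w 0 0) * ((∏ j : Fin k, om (w j.castSucc 1) (w j.succ 0)) *
          om (w (Fin.last k) 1) (p 0)) := by
      intro p
      rw [MultilinearMap.curryLeft_apply]
      have hc : (Fin.cons (Finsupp.single p 1) fun j => Finsupp.single (w j) 1 :
          Fin (k + 2) → Pairs (Fin n)) =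
          fun j => Finsupp.single (Fin.cons (α := fun _ => Fin 2 → Letter (Fin n)) p w j) 1 := by
        funext j
        refine Fin.cases ?_ (fun j => ?_) j <;> rfl
      rw [hc, polygonContr_single, Fin.prod_univ_succ, Fin.prod_univ_castSucc]
      have h0 : finRotate (k + 2) 0 = Fin.succ 0 := by rw [finRotate_apply]; simp
      have h1 : ∀ j : Fin k, finRotate (k + 2) (Fin.succ j.castSucc) = Fin.succ j.succ := by
        intro j
        rw [finRotate_apply, Fin.succ_castSucc, Fin.coeSucc_eq_succ]
      have h2 : finRotate (k + 2) (Fin.succ (Fin.last k)) = 0 := by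
        rw [Fin.succ_last, finRotate_last]
      simp only [h0, h1, h2, Fin.cons_zero, Fin.cons_succ]
    have hr : polygonContr (Fin n) (k + 1) (fun j => Finsupp.single (w j) 1) =
        (∏ j : Fin k, om (w j.castSucc 1) (w j.succ 0)) * om (w (Fin.last k) 1) (w 0 0) := by
      rw [polygonContr_single, Fin.prod_univ_castSucc, finRotate_last]
      simp only [finRotate_apply, Fin.coeSucc_eq_succ]
    rw [_root_.neg_apply, hr, omega0, map_sum]
    simp only [wedgeToTens_e]
    rw [map_sum, _root_.sum_apply]
    simp only [map_sub, _root_.sub_apply, hs, Matrix.cons_val_zero, Matrix.cons_val_one]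
    rw [← mul_neg, ← sum_om_omega0, Finset.mul_sum]
    refine Finset.sum_congr rfl fun i _ => ?_
    ring
  exact congrArg (fun f => f z) h

/-- A permutation that fixes `0` and rotates the other elements. -/
def rotateTail (k : ℕ) : Perm (Fin (k + 2)) := Perm.decomposeFin.symm (0, finRotate (k + 1))

/-- The tail has `k + 1` elements, an even number, and a cycle of even length is odd. -/
theorem sign_rotateTail {k : ℕ} (hk : Odd k) : Perm.sign (rotateTail k) = -1 := by
  rw [rotateTail, Perm.decomposeFin.symm_sign, if_pos rfl, one_mul, sign_finRotate,
    Nat.add_sub_cancel, hk.neg_one_pow]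

/-- Once `ω_0` is deleted, the remaining arguments form a smaller polygon, which has its own
rotational symmetry. -/
theorem polygonContr_rotateTail {n k : ℕ} (z : Fin (k + 2) → Pairs (Fin n))
    (hz : z 0 = wedgeToTens (Fin n) (omega0 n)) :
    polygonContr (Fin n) (k + 2) (fun j => z (rotateTail k j)) =
      polygonContr (Fin n) (k + 2) z := by
  have h1 : z = Fin.cons (α := fun _ => Pairs (Fin n)) (wedgeToTens (Fin n) (omega0 n))
      fun j => z j.succ := by
    funext j
    refine Fin.cases hz (fun j => ?_) j
    rfl
  have h2 : (fun j => z (rotateTail k j)) = Fin.cons (α := fun _ => Pairs (Fin n))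
      (wedgeToTens (Fin n) (omega0 n)) fun j => z (finRotate (k + 1) j).succ := by
    funext j
    refine Fin.cases ?_ (fun j => ?_) j
    · rw [rotateTail, Perm.decomposeFin_symm_apply_zero, hz]; rfl
    · rw [rotateTail, Perm.decomposeFin_symm_apply_succ, Equiv.swap_self]; rfl
  rw [h2, polygonContr_cons_omega0, polygonContr_rotate (fun j => z j.succ),
    ← polygonContr_cons_omega0, ← h1]

/-- Rotating the `k - 1` arguments other than `ω_0` preserves every contraction but reverses the
sign of the permutation, so the alternating sum equals its own negative. -/
theorem polygonForm_eq_zero_of_omega0 {n k : ℕ} (hk : Odd k) (hk1 : k ≠ 1)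
    (x : Fin k → ⋀[ℚ]^2 (V (Fin n))) (i : Fin k) (hi : x i = omega0 n) :
    polygonForm (Fin n) k x = 0 := by
  obtain ⟨m, rfl⟩ : ∃ m, k = m + 2 := ⟨k - 2, by have := hk.pos; omega⟩
  have hm : Odd m := by
    rw [Nat.odd_add] at hk
    exact hk.2 (by decide)
  have hrot : ∀ j : Fin (m + 2), (finRotate (m + 2) ^ (j : ℕ)) 0 = j := by
    intro j
    refine Fin.induction rfl (fun j ih => ?_) j
    rw [Fin.val_succ, pow_succ', Perm.mul_apply]
    rw [Fin.val_castSucc] at ih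
    rw [ih, finRotate_apply, Fin.coeSucc_eq_succ]
  let R : Fin (m + 2) → Perm (Fin (m + 2)) := fun j => finRotate (m + 2) ^ (j : ℕ)
  -- The rotation of all positions except `j`, obtained by carrying `j` to position `0` and back.
  let τ : Fin (m + 2) → Perm (Fin (m + 2)) := fun j => R j * rotateTail m * (R j)⁻¹
  have hτ0 : rotateTail m 0 = 0 := Perm.decomposeFin_symm_apply_zero _ _
  have hτ : ∀ j, τ j j = j := by
    intro j
    have h1 : (R j)⁻¹ j = 0 := by rw [Perm.inv_eq_iff_eq, hrot]
    simp only [τ, Perm.mul_apply, h1, hτ0]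
    exact hrot j
  have hτ' : ∀ j, (τ j)⁻¹ j = j := fun j => by rw [Perm.inv_eq_iff_eq, hτ]
  have hsign : ∀ j, Perm.sign (τ j) = -1 := by
    intro j
    rw [Perm.sign_mul, Perm.sign_mul, Perm.sign_inv, mul_right_comm, Int.units_mul_self, one_mul,
      sign_rotateTail hm]
  -- The position `s⁻¹ i` of `ω_0` depends on `s`, so the rotation has to depend on it too. Since `τ
  -- j` fixes `j`, the position is unchanged by the map, which is therefore invertible.
  let E : Perm (Perm (Fin (m + 2))) :=
    { toFun := fun s => s * τ (s⁻¹ i)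
      invFun := fun s => s * (τ (s⁻¹ i))⁻¹
      left_inv := fun s => by
        simp only [mul_inv_rev, Perm.mul_apply, hτ', mul_assoc, mul_inv_cancel, mul_one]
      right_inv := fun s => by
        simp only [mul_inv_rev, Perm.mul_apply, hτ, inv_inv, mul_assoc, inv_mul_cancel, mul_one] }
  have hE : ∀ s, (polygonContr (Fin n) (m + 2) fun j => wedgeToTens (Fin n) (x (E s j))) =
      polygonContr (Fin n) (m + 2) fun j => wedgeToTens (Fin n) (x (s j)) := by
    intro s
    set l := s⁻¹ i with hl
    have h1 := polygonContr_rotate_pow (l : ℕ) fun j => wedgeToTens (Fin n) (x (E s j))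
    have h2 := polygonContr_rotate_pow (l : ℕ) fun j => wedgeToTens (Fin n) (x (s j))
    -- Both polygons are turned so that `ω_0` stands at position `0`.
    rw [← h1, ← h2, ← polygonContr_rotateTail fun j => wedgeToTens (Fin n) (x (s (R l j)))]
    · congr 1
      funext j
      have : E s (R l j) = s (R l (rotateTail m j)) := by
        change s (R l (rotateTail m ((R l)⁻¹ (R l j)))) = _
        rw [← Perm.mul_apply (R l)⁻¹, inv_mul_cancel, Perm.one_apply]
      exact congrArg (fun t => wedgeToTens (Fin n) (x t)) this
    · have : s (R l 0) = i := by
        have : R l 0 = l := hrot l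
        rw [this, hl, ← Perm.mul_apply, mul_inv_cancel, Perm.one_apply]
      rw [this, hi]
  have hsum : polygonForm (Fin n) (m + 2) x = - polygonForm (Fin n) (m + 2) x := by
    rw [polygonForm_apply, ← Finset.sum_neg_distrib]
    refine (Equiv.sum_comp E _).symm.trans ?_
    refine Finset.sum_congr rfl fun s _ => ?_
    rw [hE, show Perm.sign (E s) = - Perm.sign s by
      simp [E, Perm.sign_mul, hsign], Units.neg_smul]
  linarith

/-- A multilinear map that vanishes as soon as one argument is `u` does not change when multiples
of `u` are added to the arguments. -/
theorem map_sub_smul_of_vanish {k : ℕ} {M N : Type*} [AddCommGroup M] [Module ℚ M]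
    [AddCommGroup N] [Module ℚ N] (f : MultilinearMap ℚ (fun _ : Fin k => M) N) (u : M)
    (hf : ∀ x : Fin k → M, ∀ i, x i = u → f x = 0) (x : Fin k → M) (c : Fin k → ℚ) :
    f (fun i => x i - c i • u) = f x := by
  have h0 : ∀ x : Fin k → M, ∀ i, ∀ r : ℚ, x i = r • u → f x = 0 := by
    intro x i r hx
    have : x = Function.update (Function.update x i u) i (r • (Function.update x i u) i) := by
      rw [Function.update_self, Function.update_idem, ← hx, Function.update_eq_self]
    rw [this, MultilinearMap.map_update_smul]
    simp only [Function.update_self, Function.update_idem]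
    rw [hf _ i (Function.update_self ..), smul_zero]
  have h1 : (fun i => x i - c i • u) = x + fun i => (- c i) • u := by
    funext i
    simp [sub_eq_add_neg]
  -- Expand over the set of positions that receive `x`; any set other than the full one leaves a
  -- multiple of `u` somewhere.
  rw [h1, MultilinearMap.map_add_univ, Finset.sum_eq_single Finset.univ]
  · simp
  · intro s _ hs
    obtain ⟨i, hi⟩ : ∃ i, i ∉ s := by
      by_contra! h
      exact hs (Finset.eq_univ_iff_forall.2 h)
    exact h0 _ i (- c i) (by simp [Finset.piecewise, hi])
  · simp

/-- The structure map replaces each representative by its projection to the kernel, which changes it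
by a multiple of `ω_0`, and the polygon form does not see such changes. -/
theorem xi_bToInf {k : ℕ} (hk : Odd k) (hk1 : k ≠ 1) (n : ℕ) (x : Fin k → ⋀[ℚ]^2 (V (Fin n))) :
    xi k (fun i => bToInf n (Submodule.Quotient.mk (x i))) = polygonForm (Fin n) k x := by
  have h1 : xi k (fun i => bToInf n (Submodule.Quotient.mk (x i))) =
      polygonForm ℕ k (fun i => wedgeMap Fin.val (projKer n (x i))) := rfl
  rw [h1, polygonForm_wedgeMap Fin.val_injective]
  have h2 : ∀ y, projKer n y =
      y - (contr (Fin n) y * (2 * (n : ℚ))⁻¹) • omega0 n := by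
    intro y
    simp [projKer, smul_smul]
  simp only [h2]
  exact map_sub_smul_of_vanish (polygonForm (Fin n) k).toMultilinearMap (omega0 n)
    (fun y i hy => polygonForm_eq_zero_of_omega0 hk hk1 y i hy) x _

/-! ### Morita's cochain in terms of words -/

/-- The tensor `ω(b, d) a ⊗ c` for the word `[a, b, c, d]`, and `0` for words of other lengths. -/
def wordCut {ι : Type} [DecidableEq ι] : List (Letter ι) → Pairs ι
  | [a, b, c, d] => om b d • Finsupp.single ![a, c] 1
  | _ => 0

/-- The linear extension of `wordCut`. -/
def cut (ι : Type) [DecidableEq ι] : Tens ι →ₗ[ℚ] Pairs ι := Finsupp.linearCombination ℚ wordCut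

theorem cut_single {ι : Type} [DecidableEq ι] (l : List (Letter ι)) :
    cut ι (Finsupp.single l 1) = wordCut l := by
  simp [cut]

theorem rotL_single {ι : Type} (l : List (Letter ι)) (c : ℚ) :
    rotL ι (Finsupp.single l c) = Finsupp.single (l.rotate 1) c := by
  simp [rotL]

theorem wordCut_of_length_ne {ι : Type} [DecidableEq ι] {l : List (Letter ι)} (h : l.length ≠ 4) :
    wordCut l = 0 := by
  match l with
  | [] | [_] | [_, _] | [_, _, _] => rfl
  | [_, _, _, _] => exact absurd rfl h
  | _ :: _ :: _ :: _ :: _ :: _ => rfl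

theorem wordContr_of_length_ne {ι : Type} [DecidableEq ι] {l : List (Letter ι)}
    (h : l.length ≠ 4) : wordContr l = 0 := by
  match l with
  | [] | [_] | [_, _] | [_, _, _] => rfl
  | [_, _, _, _] => exact absurd rfl h
  | _ :: _ :: _ :: _ :: _ :: _ => rfl

/-- The two terms of `h₂ ⊗ h₄ - h₄ ⊗ h₂` are, up to sign, cuts of the word rotated by one and by
three places. Cyclic invariance identifies both with the cut of `x`. -/
theorem wedgeToTens_tensContr {ι : Type} [DecidableEq ι] {x : Tens ι} (hx : rotL ι x = x) :
    wedgeToTens ι (tensContr ι x) = (-2 : ℚ) • cut ι x := by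
  have h : wedgeToTens ι ∘ₗ tensContr ι =
      - (cut ι ∘ₗ rotL ι) - cut ι ∘ₗ rotL ι ∘ₗ rotL ι ∘ₗ rotL ι := by
    refine Finsupp.lhom_ext' fun l => LinearMap.ext_ring ?_
    simp only [LinearMap.comp_apply, Finsupp.lsingle_apply, LinearMap.sub_apply,
      LinearMap.neg_apply, rotL_single, cut_single, tensContr, Finsupp.linearCombination_single,
      one_smul, List.rotate_rotate]
    by_cases hl : l.length = 4
    · obtain ⟨a, b, c, d, rfl⟩ : ∃ a b c d, l = [a, b, c, d] := List.length_eq_four.1 hl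
      simp only [List.rotate_cons_succ, List.rotate_zero, List.cons_append, List.nil_append,
        wordContr, wordCut, map_smul, wedgeToTens_e, om_symm c a, smul_sub, neg_smul, neg_neg]
    · rw [wordContr_of_length_ne hl, wordCut_of_length_ne (by simpa using hl),
        wordCut_of_length_ne (by simpa using hl), map_zero, sub_zero, neg_zero]
  have h1 := LinearMap.congr_fun h x
  simp only [LinearMap.comp_apply, LinearMap.sub_apply, LinearMap.neg_apply, hx] at h1
  rw [h1, neg_smul, two_smul]
  abel

/-- The alternating form on tensors which cuts words of length four and contracts the results
along a polygon. -/
def cutForm (ι : Type) [DecidableEq ι] (k : ℕ) : (Tens ι) [⋀^Fin k]→ₗ[ℚ] ℚ :=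
  MultilinearMap.alternatization ((polygonContr ι k).compLinearMap fun _ => cut ι)

theorem cutForm_apply {ι : Type} [DecidableEq ι] {k : ℕ} (x : Fin k → Tens ι) :
    cutForm ι k x =
      ∑ s : Perm (Fin k), Perm.sign s • polygonContr ι k fun j => cut ι (x (s j)) := by
  rw [cutForm, MultilinearMap.alternatization_apply]
  rfl

theorem rotL_coe {ι : Type} {P : Set ℕ} (x : cyc ι P) : rotL ι x.1 = x.1 := x.2.2

theorem moritaCochain_apply {k : ℕ} (x : Fin k → aPlus ℕ) :
    moritaCochain k x = (-2) ^ k * cutForm ℕ k fun i => (x i).1 := by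
  have h : moritaCochain k x = polygonForm ℕ k fun i => tensContr ℕ (x i).1 := rfl
  rw [h, polygonForm_apply, cutForm_apply, Finset.mul_sum]
  refine Finset.sum_congr rfl fun s _ => ?_
  simp only [wedgeToTens_tensContr (rotL_coe _)]
  rw [MultilinearMap.map_smul_univ, Finset.prod_const, Finset.card_univ, Fintype.card_fin,
    smul_eq_mul, mul_smul_comm]

theorem cut_eq_zero_of_mem {ι : Type} [DecidableEq ι] {m : ℕ} (hm : m ≠ 4) {x : Tens ι}
    (hx : x ∈ cyc ι {m}) : cut ι x = 0 := by
  rw [cut, Finsupp.linearCombination_apply, Finsupp.sum]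
  refine Finset.sum_eq_zero fun l hl => ?_
  have h : l.length = m := (Finsupp.mem_supported ℚ _).1 hx.1 hl
  rw [wordCut_of_length_ne (by rw [h]; exact hm), smul_zero]

/-- Only words of length four, of degree `2`, survive the cut, so the total degree must be `2k`. -/
theorem moritaCochain_mem_weightCochains (k : ℕ) :
    moritaCochain k ∈ weightCochains k (2 * k) := by
  intro x d hx hd
  obtain ⟨i, hi⟩ : ∃ i, d i ≠ 2 := by
    by_contra! h
    exact hd (by simp [h, mul_comm])
  rw [moritaCochain_apply, cutForm_apply, Finset.sum_eq_zero, mul_zero]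
  intro s _
  rw [MultilinearMap.map_coord_zero (i := s⁻¹ i), smul_zero]
  rw [← Perm.mul_apply, mul_inv_cancel, Perm.one_apply]
  exact cut_eq_zero_of_mem (m := d i + 2) (by omega) (hx i)

/-! ### Morita's cochain is a cocycle -/

/-- The tensor `ω(a, d) ω(b, e) c ∧ f` for the words `[a, b, c]` and `[d, e, f]`. -/
def wordPairing {ι : Type} [DecidableEq ι] : List (Letter ι) → List (Letter ι) → ⋀[ℚ]^2 (V ι)
  | [a, b, c], [d, e, f] => (om a d * om b e) • exteriorPower.ιMulti ℚ 2 ![ev c, ev f]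
  | _, _ => 0

/-- The bilinear extension of `wordPairing`. -/
def tensPairing (ι : Type) [DecidableEq ι] : Tens ι →ₗ[ℚ] Tens ι →ₗ[ℚ] ⋀[ℚ]^2 (V ι) :=
  Finsupp.linearCombination ℚ fun w => Finsupp.linearCombination ℚ fun u => wordPairing w u

theorem wedge_swap {ι : Type} (s t : Letter ι) :
    exteriorPower.ιMulti ℚ 2 ![ev s, ev t] = - exteriorPower.ιMulti ℚ 2 ![ev t, ev s] := by
  have h := (exteriorPower.ιMulti ℚ 2 (M := V ι)).map_swap ![ev t, ev s]
    (i := 0) (j := 1) (by decide)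
  rw [← h]
  congr 1
  funext i
  fin_cases i <;> rfl

theorem tensContr_single {ι : Type} [DecidableEq ι] (l : List (Letter ι)) :
    tensContr ι (Finsupp.single l 1) = wordContr l := by
  simp [tensContr]

/-- A bracket has length four only for two words of length three. Its four rotations then give two
terms, each twice, and these differ by rotating both words. -/
theorem tensContr_wordBracket {ι : Type} [DecidableEq ι] {w u : List (Letter ι)}
    (hw : 3 ≤ w.length) (hu : 3 ≤ u.length) :
    tensContr ι (wordBracket w u) =
      (2 : ℚ) • (wordPairing w u - wordPairing (w.rotate 2) (u.rotate 2)) := by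
  by_cases h : w.length = 3 ∧ u.length = 3
  · obtain ⟨a, b, c, rfl⟩ := List.length_eq_three.1 h.1
    obtain ⟨d, e, f, rfl⟩ := List.length_eq_three.1 h.2
    simp only [wordBracket, map_smul, map_add, tensContr_single, List.cons_append,
      List.nil_append, List.length_cons, List.length_nil, zero_add, Nat.reduceAdd,
      Finset.sum_range_succ, Finset.sum_range_zero, List.rotate_cons_succ, List.rotate_zero,
      wordContr, wordPairing]
    rw [om_symm f c, om_symm e b, wedge_swap f c, wedge_swap e b]
    module
  · have h1 : wordPairing w u = 0 ∧ wordPairing (w.rotate 2) (u.rotate 2) = 0 := by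
      have : ∀ w u : List (Letter ι), ¬ (w.length = 3 ∧ u.length = 3) → wordPairing w u = 0 := by
        intro w u h
        unfold wordPairing
        split
        · simp at h
        · rfl
      exact ⟨this _ _ h, this _ _ (by simpa using h)⟩
    rw [h1.1, h1.2, sub_zero, smul_zero]
    cases w with
    | nil => simp at hw
    | cons a w =>
      cases u with
      | nil => simp at hu
      | cons b u =>
        rw [wordBracket, map_smul, map_sum, Finset.sum_eq_zero, smul_zero]
        intro s _
        rw [tensContr_single, wordContr_of_length_ne]
        simp only [List.length_cons, List.length_rotate, List.length_append] at *
        omega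

/-- The word identities hold under length restrictions only, so extensionality over the whole basis
is not enough. -/
theorem bilinear_congr_on_support {W U M : Type*} [AddCommGroup M] [Module ℚ M]
    {F G : (W →₀ ℚ) →ₗ[ℚ] (U →₀ ℚ) →ₗ[ℚ] M} {x : W →₀ ℚ} {y : U →₀ ℚ}
    (h : ∀ w ∈ x.support, ∀ u ∈ y.support, F (Finsupp.single w 1) (Finsupp.single u 1) =
      G (Finsupp.single w 1) (Finsupp.single u 1)) : F x y = G x y := by
  have hs : ∀ F : (W →₀ ℚ) →ₗ[ℚ] (U →₀ ℚ) →ₗ[ℚ] M, F x y = ∑ w ∈ x.support, ∑ u ∈ y.support,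
      x w • y u • F (Finsupp.single w 1) (Finsupp.single u 1) := by
    intro F
    conv_lhs => rw [← x.sum_single, ← y.sum_single, Finsupp.sum, Finsupp.sum, map_sum F,
      LinearMap.sum_apply]
    refine Finset.sum_congr rfl fun w _ => ?_
    rw [map_sum]
    refine Finset.sum_congr rfl fun u _ => ?_
    rw [← mul_one (x w), ← mul_one (y u), ← smul_eq_mul, ← smul_eq_mul, ← Finsupp.smul_single,
      ← Finsupp.smul_single, map_smul, map_smul, LinearMap.smul_apply, smul_eq_mul, mul_one,
      smul_eq_mul, mul_one, smul_comm]
  rw [hs F, hs G]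
  exact Finset.sum_congr rfl fun w hw => Finset.sum_congr rfl fun u hu => by rw [h w hw u hu]

theorem tensBracket_single {ι : Type} [DecidableEq ι] (w u : List (Letter ι)) :
    tensBracket ι (Finsupp.single w 1) (Finsupp.single u 1) = wordBracket w u := by
  simp [tensBracket]

/-- On cyclic invariants the two terms of `tensContr_wordBracket` coincide and cancel. Thus `π_∞` is
a homomorphism to an abelian Lie algebra. -/
theorem tensContr_tensBracket {ι : Type} [DecidableEq ι] {x y : Tens ι} (hx : x ∈ aPlus ι)
    (hy : y ∈ aPlus ι) : tensContr ι (tensBracket ι x y) = 0 := by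
  have h : (tensBracket ι).compr₂ (tensContr ι) x y = ((2 : ℚ) • tensPairing ι +
      (-2 : ℚ) • (tensPairing ι).compl₁₂ (rotL ι ∘ₗ rotL ι) (rotL ι ∘ₗ rotL ι)) x y := by
    refine bilinear_congr_on_support fun w hw u hu => ?_
    rw [LinearMap.compr₂_apply, tensBracket_single,
      tensContr_wordBracket ((Finsupp.mem_supported ℚ _).1 hx.1 hw)
        ((Finsupp.mem_supported ℚ _).1 hy.1 hu)]
    simp [tensPairing, rotL_single, List.rotate_rotate, sub_eq_add_neg]
  have hx' : rotL ι x = x := hx.2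
  have hy' : rotL ι y = y := hy.2
  simpa [hx', hy'] using h

/-- Every term of the differential has a bracket in its first slot, which `π_∞` kills. -/
theorem moritaCochain_mem_cocycles (k : ℕ) : moritaCochain k ∈ cocycles (aBracket ℕ) k := by
  have h0 : ∀ x y : aPlus ℕ, piInf (aBracket ℕ x y) = 0 := fun x y =>
    Subtype.ext (tensContr_tensBracket x.2 y.2)
  rw [cocycles, LinearMap.mem_ker]
  cases k with
  | zero => rfl
  | succ k =>
    funext x
    change ∑ i : Fin (k + 2), ∑ j : Fin (k + 1), (if (i : ℕ) ≤ j then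
      (-1 : ℚ) ^ ((i : ℕ) + (j + 1)) * moritaCochain (k + 1) (Fin.cons (aBracket ℕ (x i) (x j.succ))
        fun t => x (i.succAbove (j.succAbove t))) else 0) = 0
    refine Finset.sum_eq_zero fun i _ => Finset.sum_eq_zero fun j _ => ?_
    split_ifs
    · rw [moritaCochain, AlternatingMap.compLinearMap_apply,
        AlternatingMap.map_coord_zero (i := 0), mul_zero]
      exact h0 _ _
    · rfl

/-! ### Invariance under the symplectic Lie algebra -/

/-- The action of the word `[a, b]` on the first factor of a basis element of `V ⊗ V`, by
`c ↦ ω(a, c) b`. -/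
def wordActFst {ι : Type} [DecidableEq ι] : List (Letter ι) → (Fin 2 → Letter ι) → Pairs ι
  | [a, b], p => om a (p 0) • Finsupp.single ![b, p 1] 1
  | _, _ => 0

/-- The action of the word `[a, b]` on the second factor of a basis element of `V ⊗ V`. -/
def wordActSnd {ι : Type} [DecidableEq ι] : List (Letter ι) → (Fin 2 → Letter ι) → Pairs ι
  | [a, b], p => om a (p 1) • Finsupp.single ![p 0, b] 1
  | _, _ => 0

/-- The bilinear extension of `wordActFst`. -/
def actFst (ι : Type) [DecidableEq ι] : Tens ι →ₗ[ℚ] Pairs ι →ₗ[ℚ] Pairs ι :=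
  Finsupp.linearCombination ℚ fun w => Finsupp.linearCombination ℚ fun p => wordActFst w p

/-- The bilinear extension of `wordActSnd`. -/
def actSnd (ι : Type) [DecidableEq ι] : Tens ι →ₗ[ℚ] Pairs ι →ₗ[ℚ] Pairs ι :=
  Finsupp.linearCombination ℚ fun w => Finsupp.linearCombination ℚ fun p => wordActSnd w p

theorem actFst_single {ι : Type} [DecidableEq ι] (w : List (Letter ι)) (p : Fin 2 → Letter ι) :
    actFst ι (Finsupp.single w 1) (Finsupp.single p 1) = wordActFst w p := by
  simp [actFst]

theorem actSnd_single {ι : Type} [DecidableEq ι] (w : List (Letter ι)) (p : Fin 2 → Letter ι) :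
    actSnd ι (Finsupp.single w 1) (Finsupp.single p 1) = wordActSnd w p := by
  simp [actSnd]

/-- The tensor `ω(a, h₁) ω(b, h₃) h₄ ⊗ h₂` for the words `[a, b]` and `[h₁, h₂, h₃, h₄]`. -/
def wordCross {ι : Type} [DecidableEq ι] : List (Letter ι) → List (Letter ι) → Pairs ι
  | [a, b], [h₁, h₂, h₃, h₄] => (om a h₁ * om b h₃) • Finsupp.single ![h₄, h₂] 1
  | _, _ => 0

/-- The bilinear extension of `wordCross`. -/
def tensCross (ι : Type) [DecidableEq ι] : Tens ι →ₗ[ℚ] Tens ι →ₗ[ℚ] Pairs ι :=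
  Finsupp.linearCombination ℚ fun w => Finsupp.linearCombination ℚ fun u => wordCross w u

theorem tensCross_single {ι : Type} [DecidableEq ι] (w u : List (Letter ι)) :
    tensCross ι (Finsupp.single w 1) (Finsupp.single u 1) = wordCross w u := by
  simp [tensCross]

/-- Of the four rotations of the bracket, two keep the new letter outside the contraction and give
the action on `V ⊗ V`; the other two contract it. The latter are interchanged, with opposite sign,
by rotating both words. -/
theorem cut_wordBracket {ι : Type} [DecidableEq ι] {w u : List (Letter ι)} (hw : w.length = 2)
    (hu : 3 ≤ u.length) :
    cut ι (wordBracket w u) = actFst ι (Finsupp.single w 1) (wordCut u) +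
      actSnd ι (Finsupp.single w 1) (wordCut (u.rotate 2)) +
      (wordCross w u - wordCross (w.rotate 1) (u.rotate 2)) := by
  obtain ⟨a, b, rfl⟩ := List.length_eq_two.1 hw
  by_cases h : u.length = 4
  · obtain ⟨h₁, h₂, h₃, h₄, rfl⟩ : ∃ a b c d, u = [a, b, c, d] := List.length_eq_four.1 h
    simp only [wordBracket, map_smul, map_add, cut_single, List.cons_append,
      List.nil_append, List.length_cons, List.length_nil, zero_add, Nat.reduceAdd,
      Finset.sum_range_succ, Finset.sum_range_zero, List.rotate_cons_succ, List.rotate_zero,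
      wordCut, wordCross, actFst_single, actSnd_single, wordActFst, wordActSnd,
      Matrix.cons_val_zero, Matrix.cons_val_one]
    rw [om_symm h₃ b]
    module
  · have h1 : ∀ w u : List (Letter ι), u.length ≠ 4 → wordCross w u = 0 := by
      intro w u h
      unfold wordCross
      split
      · simp at h
      · rfl
    rw [wordCut_of_length_ne h, wordCut_of_length_ne (by simpa using h), h1 _ _ h,
      h1 _ _ (by simpa using h), map_zero, map_zero, sub_zero, add_zero, add_zero]
    cases u with
    | nil => simp at hu
    | cons c u =>
      rw [wordBracket, map_smul, map_sum, Finset.sum_eq_zero, smul_zero]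
      intro s _
      rw [cut_single, wordCut_of_length_ne]
      simp only [List.length_cons, List.length_rotate, List.length_append, List.length_nil] at *
      omega

/-- Equivariance of the cut: the cross terms cancel by cyclic invariance of both arguments. -/
theorem cut_tensBracket {ι : Type} [DecidableEq ι] {X x : Tens ι} (hX : X ∈ spPart ι)
    (hx : x ∈ aPlus ι) :
    cut ι (tensBracket ι X x) = actFst ι X (cut ι x) + actSnd ι X (cut ι x) := by
  have h : (tensBracket ι).compr₂ (cut ι) X x = ((actFst ι).compl₂ (cut ι) +
      (actSnd ι).compl₂ (cut ι ∘ₗ rotL ι ∘ₗ rotL ι) +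
      (tensCross ι - (tensCross ι).compl₁₂ (rotL ι) (rotL ι ∘ₗ rotL ι))) X x := by
    refine bilinear_congr_on_support fun w hw u hu => ?_
    rw [LinearMap.compr₂_apply, tensBracket_single,
      cut_wordBracket ((Finsupp.mem_supported ℚ _).1 hX.1 hw)
        ((Finsupp.mem_supported ℚ _).1 hx.1 hu)]
    simp only [LinearMap.add_apply, LinearMap.sub_apply, LinearMap.compl₂_apply,
      LinearMap.compl₁₂_apply, LinearMap.comp_apply, rotL_single, cut_single, tensCross_single,
      List.rotate_rotate]
  have hX' : rotL ι X = X := hX.2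
  have hx' : rotL ι x = x := hx.2
  simpa [hX', hx'] using h

/-- The value `ω(a, c) ω(b, d)` of the word `[a, b]` on the pair `(c, d)`. -/
def wordForm {ι : Type} [DecidableEq ι] (c d : Letter ι) : List (Letter ι) → ℚ
  | [a, b] => om a c * om b d
  | _ => 0

/-- Cyclic invariance in length two is symmetry of the tensor, which is what places `X` in the
symplectic Lie algebra. -/
theorem linearCombination_wordForm_comm {ι : Type} [DecidableEq ι] (c d : Letter ι) {X : Tens ι}
    (hX : rotL ι X = X) : Finsupp.linearCombination ℚ (wordForm c d) X =
      Finsupp.linearCombination ℚ (wordForm d c) X := by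
  have h : Finsupp.linearCombination ℚ (wordForm c d) ∘ₗ rotL ι =
      Finsupp.linearCombination ℚ (wordForm d c) := by
    refine Finsupp.lhom_ext' fun w => LinearMap.ext_ring ?_
    simp only [LinearMap.comp_apply, Finsupp.lsingle_apply, rotL_single,
      Finsupp.linearCombination_single, one_smul]
    match w with
    | [] | [_] => simp [wordForm]
    | [a, b] => simp [wordForm, mul_comm]
    | [_, _, _] => simp [wordForm]
    | _ :: _ :: _ :: _ :: l => cases l <;> simp [wordForm]
  rw [← h, LinearMap.comp_apply, hX]

theorem polygonContr_update_single {ι : Type} [DecidableEq ι] {k : ℕ} (w : Fin k → Fin 2 → Letter ι)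
    (i : Fin k) (p : Fin 2 → Letter ι) :
    polygonContr ι k (Function.update (fun j => Finsupp.single (w j) 1) i (Finsupp.single p 1)) =
      ∏ j, om (Function.update w i p j 1) (Function.update w i p (finRotate k j) 0) := by
  rw [← polygonContr_single]
  congr 1
  funext j
  by_cases h : j = i
  · subst h; simp
  · simp [h]

/-- Only the side leaving `i` involves the second entry at `i`; there `ω` is replaced by the
bilinear form of `X`. -/
theorem polygonContr_actSnd_single {ι : Type} [DecidableEq ι] {k : ℕ} (X : Tens ι)
    (w : Fin k → Fin 2 → Letter ι) (i : Fin k) :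
    polygonContr ι k (Function.update (fun j => Finsupp.single (w j) 1) i
      (actSnd ι X (Finsupp.single (w i) 1))) =
      (∏ j ∈ univ.erase i, om (w j 1) (w (finRotate k j) 0)) *
        Finsupp.linearCombination ℚ (wordForm (w i 1) (w (finRotate k i) 0)) X := by
  have h : ((polygonContr ι k).toLinearMap (fun j => Finsupp.single (w j) 1) i) ∘ₗ
      (actSnd ι).flip (Finsupp.single (w i) 1) =
      (∏ j ∈ univ.erase i, om (w j 1) (w (finRotate k j) 0)) •
        Finsupp.linearCombination ℚ (wordForm (w i 1) (w (finRotate k i) 0)) := by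
    refine Finsupp.lhom_ext' fun W => LinearMap.ext_ring ?_
    simp only [LinearMap.comp_apply, Finsupp.lsingle_apply, LinearMap.flip_apply, actSnd_single,
      LinearMap.smul_apply, Finsupp.linearCombination_single, smul_eq_mul]
    match W with
    | [] | [_] | _ :: _ :: _ :: _ => simp [wordActSnd, wordForm]
    | [a, b] =>
      rw [wordActSnd, map_smul, MultilinearMap.toLinearMap_apply, polygonContr_update_single,
        ← Finset.mul_prod_erase _ _ (mem_univ i)]
      have h1 : ∀ j, Function.update w i ![w i 0, b] j 0 = w j 0 := by
        intro j
        by_cases hj : j = i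
        · subst hj; simp
        · simp [hj]
      have h2 : ∀ j ∈ univ.erase i, om (Function.update w i ![w i 0, b] j 1)
          (Function.update w i ![w i 0, b] (finRotate k j) 0) =
          om (w j 1) (w (finRotate k j) 0) := by
        intro j hj
        rw [h1, Function.update_of_ne (Finset.ne_of_mem_erase hj)]
      rw [Finset.prod_congr rfl h2, h1]
      simp only [Function.update_self, Matrix.cons_val_one, Matrix.cons_val_zero, wordForm,
        smul_eq_mul]
      ring
  exact LinearMap.congr_fun h X

/-- The same side seen from its other end. The minus sign is the antisymmetry of `ω`. -/
theorem polygonContr_actFst_single {ι : Type} [DecidableEq ι] {k : ℕ} (X : Tens ι)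
    (w : Fin k → Fin 2 → Letter ι) (i : Fin k) :
    polygonContr ι k (Function.update (fun j => Finsupp.single (w j) 1) (finRotate k i)
      (actFst ι X (Finsupp.single (w (finRotate k i)) 1))) =
      - ((∏ j ∈ univ.erase i, om (w j 1) (w (finRotate k j) 0)) *
        Finsupp.linearCombination ℚ (wordForm (w (finRotate k i) 0) (w i 1)) X) := by
  have h : ((polygonContr ι k).toLinearMap (fun j => Finsupp.single (w j) 1) (finRotate k i)) ∘ₗ
      (actFst ι).flip (Finsupp.single (w (finRotate k i)) 1) =
      - ((∏ j ∈ univ.erase i, om (w j 1) (w (finRotate k j) 0)) •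
        Finsupp.linearCombination ℚ (wordForm (w (finRotate k i) 0) (w i 1))) := by
    refine Finsupp.lhom_ext' fun W => LinearMap.ext_ring ?_
    simp only [LinearMap.comp_apply, Finsupp.lsingle_apply, LinearMap.flip_apply, actFst_single,
      LinearMap.smul_apply, Finsupp.linearCombination_single, smul_eq_mul,
      LinearMap.neg_apply]
    match W with
    | [] | [_] | _ :: _ :: _ :: _ => simp [wordActFst, wordForm]
    | [a, b] =>
      rw [wordActFst, map_smul, MultilinearMap.toLinearMap_apply, polygonContr_update_single,
        ← Finset.mul_prod_erase _ _ (mem_univ i)]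
      set l := finRotate k i with hl
      have h1 : ∀ j, Function.update w l ![b, w l 1] j 1 = w j 1 := by
        intro j
        by_cases hj : j = l
        · rw [hj]; simp
        · simp [hj]
      have h2 : ∀ j ∈ univ.erase i, om (Function.update w l ![b, w l 1] j 1)
          (Function.update w l ![b, w l 1] (finRotate k j) 0) =
          om (w j 1) (w (finRotate k j) 0) := by
        intro j hj
        rw [h1, Function.update_of_ne]
        intro h
        exact Finset.ne_of_mem_erase hj ((finRotate k).injective (h.trans hl))
      rw [Finset.prod_congr rfl h2, h1]
      simp only [Function.update_self, Matrix.cons_val_zero, wordForm, smul_eq_mul]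
      rw [om_symm (w i 1) b]
      ring
  exact LinearMap.congr_fun h X

theorem compLinearMap_update_id {k : ℕ} {M N : Type*} [AddCommGroup M] [Module ℚ M]
    [AddCommGroup N] [Module ℚ N] (f : MultilinearMap ℚ (fun _ : Fin k => M) N) (i : Fin k)
    (g : M →ₗ[ℚ] M) (y : Fin k → M) :
    f.compLinearMap (Function.update (fun _ => LinearMap.id) i g) y =
      f (Function.update y i (g (y i))) := by
  rw [MultilinearMap.compLinearMap_apply]
  congr 1
  funext j
  by_cases h : j = i
  · subst h; simp
  · simp [h]

/-- Infinitesimal invariance of `ω` along one side: moving `X` from one end to the other costs a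
sign. -/
theorem polygonContr_actSnd {ι : Type} [DecidableEq ι] {k : ℕ} {X : Tens ι} (hX : rotL ι X = X)
    (y : Fin k → Pairs ι) (i : Fin k) :
    polygonContr ι k (Function.update y i (actSnd ι X (y i))) =
      - polygonContr ι k (Function.update y (finRotate k i) (actFst ι X (y (finRotate k i)))) := by
  have h : (polygonContr ι k).compLinearMap
        (Function.update (fun _ => LinearMap.id) i (actSnd ι X)) =
      - (polygonContr ι k).compLinearMap
        (Function.update (fun _ => LinearMap.id) (finRotate k i) (actFst ι X)) := by
    refine multilinear_ext_single fun w => ?_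
    rw [_root_.neg_apply, compLinearMap_update_id, compLinearMap_update_id,
      polygonContr_actSnd_single X w i, polygonContr_actFst_single X w i, neg_neg,
      linearCombination_wordForm_comm _ _ hX]
  have h1 := congrArg (fun f => f y) h
  simp only [_root_.neg_apply, compLinearMap_update_id] at h1
  exact h1

/-- Regrouping the sum over vertices by sides makes the two ends of each side cancel. -/
theorem sum_polygonContr_act {ι : Type} [DecidableEq ι] {k : ℕ} {X : Tens ι}
    (hX : rotL ι X = X) (y : Fin k → Pairs ι) :
    ∑ i, polygonContr ι k (Function.update y i (actFst ι X (y i) + actSnd ι X (y i))) = 0 := by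
  simp only [MultilinearMap.map_update_add]
  rw [Finset.sum_add_distrib, Finset.sum_congr rfl fun i _ => polygonContr_actSnd hX y i,
    Finset.sum_neg_distrib, Equiv.sum_comp (finRotate k) fun i =>
      polygonContr ι k (Function.update y i (actFst ι X (y i))), add_neg_cancel]

theorem lieDer_moritaCochain {k : ℕ} (X : spPart ℕ) :
    lieDer k X (moritaCochain k) = 0 := by
  funext x
  change ∑ i, moritaCochain k (Function.update x i (spAct ℕ X (x i))) = 0
  simp only [moritaCochain_apply, cutForm_apply]
  rw [← Finset.mul_sum, Finset.sum_comm, Finset.sum_eq_zero, mul_zero]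
  intro s _
  rw [← Finset.smul_sum, ← Equiv.sum_comp s]
  have h := sum_polygonContr_act (rotL_coe X) fun j => cut ℕ (x (s j)).1
  convert smul_zero (Perm.sign s) using 2
  refine Eq.trans (Finset.sum_congr rfl fun i _ => ?_) h
  congr 1
  funext j
  by_cases hj : j = i
  · subst hj
    rw [Function.update_self, Function.update_self]
    exact cut_tensBracket X.2 (x (s j)).2
  · rw [Function.update_of_ne hj, Function.update_of_ne (s.injective.ne hj)]

/-! ### Primitivity -/

theorem cut_tensMap {ι κ : Type} [DecidableEq ι] [DecidableEq κ] {f : ι → κ}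
    (hf : Function.Injective f) (x : Tens ι) : cut κ (tensMap f x) = pairsMap f (cut ι x) := by
  have h : cut κ ∘ₗ tensMap f = pairsMap f ∘ₗ cut ι := by
    refine Finsupp.lhom_ext' fun l => LinearMap.ext_ring ?_
    simp only [LinearMap.comp_apply, Finsupp.lsingle_apply, tensMap, Finsupp.lmapDomain_apply,
      Finsupp.mapDomain_single, cut_single]
    by_cases hl : l.length = 4
    · obtain ⟨a, b, c, d, rfl⟩ : ∃ a b c d, l = [a, b, c, d] := List.length_eq_four.1 hl
      simp only [List.map_cons, List.map_nil, wordCut, map_smul, pairsMap_single, om_map hf]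
      congr 2
      funext i
      fin_cases i <;> rfl
    · rw [wordCut_of_length_ne hl, wordCut_of_length_ne (by simpa using hl), map_zero]
  exact LinearMap.congr_fun h x

theorem om_map_of_ne {ι κ : Type} [DecidableEq κ] {f g : ι → κ} (h : ∀ i j, f i ≠ g j)
    (s t : Letter ι) : om (Sum.map f f s) (Sum.map g g t) = 0 := by
  rcases s with i | i <;> rcases t with j | j <;> simp [om, h i j]

/-- The side from `i` to its successor joins two orthogonal subspaces, so its contraction vanishes.
-/
theorem polygonContr_piecewise {ι κ : Type} [DecidableEq κ] {f g : ι → κ}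
    (h : ∀ i j, f i ≠ g j) {k : ℕ} (s : Finset (Fin k)) (i : Fin k)
    (hi : ¬ (i ∈ s ↔ finRotate k i ∈ s)) (y z : Fin k → Pairs ι) :
    polygonContr κ k (s.piecewise (fun j => pairsMap f (y j)) fun j => pairsMap g (z j)) = 0 := by
  have h1 : (polygonContr κ k).compLinearMap
      (fun j => if j ∈ s then pairsMap f else pairsMap g) = 0 := by
    refine multilinear_ext_single fun w => ?_
    have h2 : (fun j => (if j ∈ s then pairsMap f else pairsMap g) (Finsupp.single (w j) (1 : ℚ))) =
        fun j => Finsupp.single (if j ∈ s then Sum.map f f ∘ w j else Sum.map g g ∘ w j) 1 := by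
      funext j
      split_ifs <;> rw [pairsMap_single]
    rw [MultilinearMap.compLinearMap_apply, h2, polygonContr_single]
    refine Finset.prod_eq_zero (mem_univ i) ?_
    by_cases h3 : i ∈ s <;> by_cases h4 : finRotate k i ∈ s
    · exact absurd (iff_of_true h3 h4) hi
    · rw [if_pos h3, if_neg h4]
      exact om_map_of_ne h _ _
    · rw [if_neg h3, if_pos h4]
      exact om_map_of_ne (fun i j => (h j i).symm) _ _
    · exact absurd (iff_of_false h3 h4) hi
  have h2 := congrArg (fun F => F (s.piecewise y z)) h1
  simp only [MultilinearMap.compLinearMap_apply] at h2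
  refine Eq.trans (congrArg _ ?_) h2
  funext j
  by_cases hj : j ∈ s <;> simp [hj]

/-- The polygon is connected, so a mixed choice of summands has a side with ends in different
halves. For `k = 0` the empty product would be counted twice. -/
theorem polygonContr_add {ι κ : Type} [DecidableEq ι] [DecidableEq κ] {f g : ι → κ}
    (hf : Function.Injective f) (hg : Function.Injective g) (h : ∀ i j, f i ≠ g j) {k : ℕ}
    (hk : k ≠ 0) (y z : Fin k → Pairs ι) :
    polygonContr κ k (fun j => pairsMap f (y j) + pairsMap g (z j)) =
      polygonContr ι k y + polygonContr ι k z := by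
  obtain ⟨m, rfl⟩ := Nat.exists_eq_succ_of_ne_zero hk
  have h1 : (fun j => pairsMap f (y j) + pairsMap g (z j)) =
      (fun j => pairsMap f (y j)) + fun j => pairsMap g (z j) := rfl
  have h2 : (∅ : Finset (Fin (m + 1))) ≠ univ := Finset.univ_nonempty.ne_empty.symm
  rw [h1, MultilinearMap.map_add_univ, ← Finset.sum_subset (Finset.subset_univ {∅, univ}),
    Finset.sum_pair h2]
  · rw [Finset.piecewise_empty, Finset.piecewise_univ, polygonContr_pairsMap hf,
      polygonContr_pairsMap hg, add_comm]
  · intro s _ hs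
    by_cases hi : ∃ i, ¬ (i ∈ s ↔ finRotate (m + 1) i ∈ s)
    · obtain ⟨i, hi⟩ := hi
      exact polygonContr_piecewise h s i hi y z
    -- A set of vertices stable under rotation is empty or everything.
    · push Not at hi
      have h0 : ∀ i : Fin (m + 1), i ∈ s ↔ 0 ∈ s := by
        intro i
        refine Fin.induction Iff.rfl (fun j ih => ?_) i
        rw [← ih, hi j.castSucc, finRotate_apply, Fin.coeSucc_eq_succ]
      refine absurd ?_ hs
      rw [Finset.mem_insert, Finset.mem_singleton]
      by_cases hz : (0 : Fin (m + 1)) ∈ s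
      · exact .inr (Finset.eq_univ_iff_forall.2 fun i => (h0 i).2 hz)
      · exact .inl (Finset.eq_empty_iff_forall_notMem.2 fun i hi => hz ((h0 i).1 hi))

theorem primDefect_moritaCochain {k : ℕ} (hk : k ≠ 0) : primDefect k (moritaCochain k) = 0 := by
  funext x
  have he : Function.Injective fun i : ℕ => 2 * i := fun i j h => by simpa using h
  have ho : Function.Injective fun i : ℕ => 2 * i + 1 := fun i j h => by simpa using h
  have heo : ∀ i j : ℕ, 2 * i ≠ 2 * j + 1 := fun i j => by omega
  have hcut : ∀ x : aPlus ℕ × aPlus ℕ, cut ℕ (sumMap x).1 =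
      pairsMap (fun i => 2 * i) (cut ℕ x.1.1) + pairsMap (fun i => 2 * i + 1) (cut ℕ x.2.1) := by
    intro x
    rw [← cut_tensMap he, ← cut_tensMap ho, ← map_add]
    rfl
  change moritaCochain k (fun i => sumMap (x i)) - moritaCochain k (fun i => (x i).1) -
    moritaCochain k (fun i => (x i).2) = 0
  simp only [moritaCochain_apply, cutForm_apply, hcut, polygonContr_add he ho heo hk, smul_add,
    Finset.sum_add_distrib]
  ring

theorem mk_moritaCochain_mem_PHsp {k : ℕ} (hk : k ≠ 0) :
    Coh.mk (aBracket ℕ) k ⟨moritaCochain k, moritaCochain_mem_cocycles k⟩ ∈ PHsp k (2 * k) := by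
  refine Submodule.mem_map_of_mem ?_
  refine ⟨⟨moritaCochain_mem_weightCochains k, ?_⟩, ?_⟩
  · rw [SetLike.mem_coe, Submodule.mem_iInf]
    intro X
    rw [Submodule.mem_comap]
    change lieDer k X (moritaCochain k) ∈ coboundaries (aBracket ℕ) k
    rw [lieDer_moritaCochain]
    exact Submodule.zero_mem _
  · change primDefect k (moritaCochain k) ∈ coboundaries (prodBracket (aBracket ℕ)) k
    rw [primDefect_moritaCochain hk]
    exact Submodule.zero_mem _

/-! ### Automorphisms of the polygon graph -/

/-- Every vertex has a half-edge, so the bijection of half-edges determines the vertex permutation.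
-/
theorem RibbonIso.ext_toEquiv {k : ℕ} {X Y : RibbonGraph k} {φ ψ : RibbonIso X Y}
    (h : ∀ x, φ.toEquiv x = ψ.toEquiv x) : φ = ψ := by
  have hp : φ.perm = ψ.perm := by
    ext i
    obtain ⟨x, rfl⟩ := X.vert_surjective i
    rw [← φ.map_vert, ← ψ.map_vert, h]
  have he : φ.toEquiv = ψ.toEquiv := Equiv.ext h
  cases φ
  cases ψ
  cases hp
  cases he
  rfl

theorem prod_out_polygonGraph {k : ℕ} {M : Type*} [CommMonoid M] (F : Fin k × Fin 4 → M) :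
    ∏ h : (polygonGraph k).H with (polygonGraph k).out h = true, F h =
      ∏ i, F (i, 1) * F (i, 2) := by
  change ∏ h : Fin k × Fin 4 with (decide (h.2 = 1 ∨ h.2 = 2)) = true, F h = _
  rw [Finset.prod_filter, Fintype.prod_prod_type]
  refine Finset.prod_congr rfl fun i _ => ?_
  rw [Fin.prod_univ_four]
  simp

/-- The bijection `(i, a) ↦ (s i, a + r (s i))` of half-edges. -/
def placed {k : ℕ} (s : Perm (Fin k)) (r : Fin k → Fin 4) : Perm (Fin k × Fin 4) where
  toFun h := (s h.1, h.2 + r (s h.1))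
  invFun h := (s.symm h.1, h.2 - r h.1)
  left_inv h := by simp
  right_inv h := by simp

theorem placed_apply {k : ℕ} (s : Perm (Fin k)) (r : Fin k → Fin 4) (i : Fin k) (a : Fin 4) :
    placed s r (i, a) = (s i, a + r (s i)) := rfl

theorem placed_injective {k : ℕ} {s s' : Perm (Fin k)} {r r' : Fin k → Fin 4}
    (h : ∀ x, placed s r x = placed s' r' x) : s = s' ∧ r = r' := by
  have h1 : s = s' := Equiv.ext fun i => congrArg Prod.fst (h (i, 0))
  subst h1
  refine ⟨rfl, funext fun i => ?_⟩
  have h2 := congrArg Prod.snd (h (s.symm i, 0))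
  simpa [placed_apply] using h2

/-- A bijection of half-edges that is compatible with the cyclic orders is given by `placed`. -/
theorem exists_placed {k : ℕ} (e : Perm (Fin k × Fin 4)) (s : Perm (Fin k))
    (hs : ∀ h, (e h).1 = s h.1) (he : ∀ i a, e (i, a + 1) = ((e (i, a)).1, (e (i, a)).2 + 1)) :
    ∃ r, e = placed s r := by
  refine ⟨fun j => (e (s.symm j, 0)).2, Equiv.ext fun h => ?_⟩
  obtain ⟨i, a⟩ := h
  rw [placed_apply]
  refine Prod.ext (hs _) ?_
  simp only [Equiv.symm_apply_apply]
  have h1 : ∀ n : ℕ, (e (i, (n • (1 : Fin 4)))).2 = n • (1 : Fin 4) + (e (i, 0)).2 := by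
    intro n
    induction n with
    | zero => simp
    | succ n ih =>
      rw [succ_nsmul, he, ih]
      exact add_right_comm _ _ _
  have h2 : ∀ a : Fin 4, (a : ℕ) • (1 : Fin 4) = a := by decide
  have h3 := h1 a
  rwa [h2] at h3

/-- A translation has order dividing the odd number `k`. -/
theorem sign_addLeft {k : ℕ} [NeZero k] (hk : Odd k) (c : Fin k) :
    Perm.sign (Equiv.addLeft c) = 1 := by
  have h : (Equiv.addLeft c) ^ k = 1 := by
    have h0 : k • c = 0 := by
      have := card_nsmul_eq_zero' (x := c)
      simpa using this
    have hn : ∀ (n : ℕ) (i : Fin k), (Equiv.addLeft c ^ n) i = n • c + i := by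
      intro n
      induction n with
      | zero => simp
      | succ n ih =>
        intro i
        rw [pow_succ', Perm.mul_apply, ih, Equiv.coe_addLeft, succ_nsmul', add_assoc]
    refine Equiv.ext fun i => ?_
    rw [hn, h0, zero_add, Perm.one_apply]
  have h1 := congrArg Perm.sign h
  rw [map_pow, Perm.sign_one] at h1
  rcases Int.units_eq_one_or (Perm.sign (Equiv.addLeft c)) with h2 | h2
  · exact h2
  · rw [h2, hk.neg_one_pow] at h1
    exact absurd h1 (by decide)

/-- For odd `k`, negation fixes only `0` and so is a product of `(k - 1) / 2` transpositions. That
this number is even is where `k ≡ 1 mod 4` enters, rather than just oddness. -/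
theorem sign_neg_fin {k : ℕ} [NeZero k] (hk : k % 4 = 1) :
    Perm.sign (Equiv.neg (Fin k)) = 1 := by
  have h2 : (Equiv.neg (Fin k)) ^ 2 = 1 := by
    ext i
    simp [pow_two]
  have h1 : Fintype.card (Function.fixedPoints (Equiv.neg (Fin k))) = 1 := by
    rw [Fintype.card_eq_one_iff]
    refine ⟨⟨0, by simp [Function.IsFixedPt]⟩, fun i => Subtype.ext ?_⟩
    obtain ⟨i, hi⟩ := i
    have hi' : -i = i := hi
    have h3 : i + i = 0 := by
      nth_rewrite 1 [← hi']
      exact neg_add_cancel i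
    have h4 : k • i = 0 := by
      have := card_nsmul_eq_zero' (x := i)
      simpa using this
    obtain ⟨t, ht⟩ : ∃ t, k = 2 * t + 1 := ⟨k / 2, by omega⟩
    have h5 : k • i = t • (i + i) + i := by
      rw [show k • i = (2 * t + 1) • i from congrArg (· • i) ht]
      rw [add_nsmul, one_nsmul, mul_comm 2 t, mul_nsmul', two_nsmul]
    rw [h4, h3, smul_zero, zero_add] at h5
    exact h5.symm
  rw [Perm.sign_of_pow_two_eq_one h2, Fintype.card_fin, h1]
  refine Even.neg_one_pow ⟨k / 4, by omega⟩

/-- The translations (`b = false`) and reflections (`b = true`) of a cyclic group. -/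
def dihedralPerm {k : ℕ} [NeZero k] (c : Fin k) (b : Bool) : Perm (Fin k) :=
  (if b then Equiv.neg (Fin k) else 1).trans (Equiv.addLeft c)

theorem sign_dihedralPerm {k : ℕ} [NeZero k] (hk : k % 4 = 1) (c : Fin k) (b : Bool) :
    Perm.sign (dihedralPerm c b) = 1 := by
  have hk' : Odd k := Nat.odd_iff.2 (by omega)
  rw [dihedralPerm, Perm.sign_trans, sign_addLeft hk', one_mul]
  cases b
  · simp
  · simp [sign_neg_fin hk]

/-- The automorphism of the polygon graph given by an element of the dihedral group. -/
def polygonAut {k : ℕ} [NeZero k] (c : Fin k) (b : Bool) :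
    RibbonIso (polygonGraph k) (polygonGraph k) where
  toEquiv := placed (dihedralPerm c b) fun _ => if b then 2 else 0
  map_rot h := by
    obtain ⟨i, a⟩ := h
    exact Prod.ext rfl (add_right_comm _ _ _)
  map_flip h := by
    obtain ⟨i, a⟩ := h
    have hs' : ∀ j, (finRotate k).symm j = j - 1 := fun j => by
      rw [Equiv.symm_apply_eq, finRotate_apply, sub_add_cancel]
    change placed _ _ (polygonFlip (i, a)) = polygonFlip (placed _ _ (i, a))
    cases b <;> fin_cases a <;>
      simp [placed_apply, polygonFlip, dihedralPerm, hs', finRotate_apply]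
    · exact (add_sub_assoc _ _ _).symm
    · exact (add_assoc _ _ _).symm
    · rw [sub_eq_add_neg, add_comm 1, add_assoc]
    · rw [add_comm (-1) (-i), ← add_assoc, ← sub_eq_add_neg]
  perm := dihedralPerm c b
  map_vert h := rfl

/-- A reflection reverses all `k` loops and all `k` polygon edges, an even number in total, so only
the vertex permutation could contribute a sign. -/
theorem sgn_polygonAut {k : ℕ} [NeZero k] (hk : k % 4 = 1) (c : Fin k) (b : Bool) :
    (polygonAut c b).sgn = 1 := by
  have h1 : (polygonAut c b).perm = dihedralPerm c b := rfl
  rw [RibbonIso.sgn, h1, sign_dihedralPerm hk, one_mul]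
  refine (prod_out_polygonGraph fun h => if (polygonGraph k).out ((polygonAut c b).toEquiv h) then
    (1 : ℤˣ) else -1).trans ?_
  refine Finset.prod_eq_one fun i _ => ?_
  change (if decide ((1 : Fin 4) + (if b then 2 else 0) = 1 ∨
      (1 : Fin 4) + (if b then 2 else 0) = 2) = true then (1 : ℤˣ) else -1) *
    (if decide ((2 : Fin 4) + (if b then 2 else 0) = 1 ∨
      (2 : Fin 4) + (if b then 2 else 0) = 2) = true then (1 : ℤˣ) else -1) = 1
  cases b <;> decide

/-- Loops go to loops, which forces the rotation at each vertex to be `0` or `2`. This choice, made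
at one vertex, propagates along the polygon. For `k = 1` the polygon edge is itself a loop and there
are further automorphisms. -/
theorem polygonAut_bijective {k : ℕ} [NeZero k] (hk : 2 ≤ k) :
    Function.Bijective fun p : Fin k × Bool => polygonAut p.1 p.2 := by
  obtain ⟨m, rfl⟩ := Nat.exists_eq_add_of_le' hk
  constructor
  · rintro ⟨c, b⟩ ⟨c', b'⟩ h
    have h1 := congrArg (fun φ : RibbonIso (polygonGraph (m + 2)) (polygonGraph (m + 2)) =>
      (φ.toEquiv ((0, 0) : Fin (m + 2) × Fin 4) : Fin (m + 2) × Fin 4)) h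
    have h2 : (dihedralPerm c b 0, (0 : Fin 4) + if b then 2 else 0) =
      (dihedralPerm c' b' 0, (0 : Fin 4) + if b' then 2 else 0) := h1
    cases b <;> cases b' <;> simp [dihedralPerm] at h2 <;> simp [h2]
  · intro φ
    have hs' : ∀ j, (finRotate (m + 2)).symm j = j - 1 := fun j => by
      rw [Equiv.symm_apply_eq, finRotate_apply, sub_add_cancel]
    obtain ⟨r, hr⟩ := exists_placed φ.toEquiv φ.perm φ.map_vert fun i a => φ.map_rot (i, a)
    set s := φ.perm
    have hf : ∀ h : Fin (m + 2) × Fin 4,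
        placed s r (polygonFlip h) = polygonFlip (placed s r h) := by
      intro h
      rw [← hr]
      exact φ.map_flip h
    have hr1 : ∀ i, r (s i) = 0 ∨ r (s i) = 2 := by
      intro i
      -- An odd rotation would send the loop at `i` to a polygon edge with both ends at one vertex,
      -- impossible for at least two vertices.
      have h := hf (i, 1)
      have hall : ∀ a : Fin 4, a = 0 ∨ a = 1 ∨ a = 2 ∨ a = 3 := by decide
      rcases hall (r (s i)) with h0 | h0 | h0 | h0
      · exact .inl h0
      · simp [placed_apply, polygonFlip, h0, finRotate_apply] at h
      · exact .inr h0
      · simp [placed_apply, polygonFlip, h0, hs', eq_sub_iff_add_eq] at h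
    have hr0 : ∀ i, r (s i) = 0 → r (s (i + 1)) = 0 ∧ s (i + 1) = s i + 1 := by
      intro i h0
      have h := hf (i, 2)
      simp [placed_apply, polygonFlip, h0, finRotate_apply] at h
      exact ⟨h.2, h.1⟩
    have hr2 : ∀ i, r (s i) = 2 → r (s (i + 1)) = 2 ∧ s (i + 1) = s i - 1 := by
      intro i h0
      have h := hf (i, 2)
      simp [placed_apply, polygonFlip, h0, finRotate_apply, hs'] at h
      exact ⟨h.2, h.1⟩
    -- The rotation at vertex `0` decides between translation and reflection; induction along the
    -- polygon edges does the rest.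
    obtain ⟨b, hb⟩ : ∃ b : Bool, ∀ i, r (s i) = (if b then 2 else 0) ∧
        s i = dihedralPerm (s 0) b i := by
      rcases hr1 0 with h0 | h0
      · refine ⟨false, fun i => Fin.induction ?_ (fun j ih => ?_) i⟩
        · simp [h0, dihedralPerm]
        · have h3 := hr0 _ ih.1
          rw [Fin.coeSucc_eq_succ] at h3
          refine ⟨h3.1, ?_⟩
          rw [h3.2, ih.2, ← Fin.coeSucc_eq_succ]
          simp [dihedralPerm, add_assoc]
      · refine ⟨true, fun i => Fin.induction ?_ (fun j ih => ?_) i⟩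
        · simp [h0, dihedralPerm]
        · have h3 := hr2 _ ih.1
          rw [Fin.coeSucc_eq_succ] at h3
          refine ⟨h3.1, ?_⟩
          rw [h3.2, ih.2, ← Fin.coeSucc_eq_succ]
          simp only [dihedralPerm, if_true, Equiv.trans_apply, Equiv.neg_apply,
            Equiv.coe_addLeft]
          rw [neg_add, ← add_assoc, sub_eq_add_neg]
    refine ⟨(s 0, b), RibbonIso.ext_toEquiv fun h => ?_⟩
    obtain ⟨i, a⟩ := h
    rw [hr]
    refine Prod.ext (hb i).2.symm ?_
    change a + (if b then 2 else 0) = a + r (s i)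
    rw [(hb i).1]

theorem card_polygonAut {k : ℕ} (hk : 2 ≤ k) :
    Nat.card (RibbonIso (polygonGraph k) (polygonGraph k)) = 2 * k := by
  have : NeZero k := ⟨by omega⟩
  rw [← Nat.card_eq_of_bijective _ (polygonAut_bijective hk), Nat.card_eq_fintype_card]
  simp [mul_comm]

/-- So `X_k` is not isomorphic to `-X_k`, and all isomorphisms from it to a given graph have the
same sign. -/
theorem sgn_aut_polygonGraph {k : ℕ} (hk : k % 4 = 1) (hk1 : k ≠ 1)
    (φ : RibbonIso (polygonGraph k) (polygonGraph k)) : φ.sgn = 1 := by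
  have : NeZero k := ⟨by omega⟩
  obtain ⟨p, rfl⟩ := (polygonAut_bijective (k := k) (by omega)).2 φ
  exact sgn_polygonAut hk _ _

/-! ### Counting isomorphisms with the polygon graph -/

theorem charFun_polygonGraph_self {k : ℕ} (hk : k % 4 = 1) (hk1 : k ≠ 1) :
    charFun (polygonGraph k) (polygonGraph k) = 1 := by
  have : NeZero k := ⟨by omega⟩
  rw [charFun, if_pos ⟨polygonAut 0 false, sgn_aut_polygonGraph hk hk1 _⟩, if_neg, sub_zero]
  rintro ⟨φ, hφ⟩
  rw [sgn_aut_polygonGraph hk hk1 φ] at hφ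
  exact absurd hφ (by decide)

theorem charFun_polygonGraph {k : ℕ} (hk : k % 4 = 1) (hk1 : k ≠ 1) {Y : RibbonGraph k}
    (φ : RibbonIso (polygonGraph k) Y) : charFun (polygonGraph k) Y = ((φ.sgn : ℤ) : ℚ) := by
  have h := charFun_iso (polygonGraph k) φ
  rw [charFun_polygonGraph_self hk hk1] at h
  rcases Int.units_eq_one_or φ.sgn with h1 | h1 <;> rw [h1] at h ⊢ <;> simp at h ⊢ <;> linarith

theorem charFun_eq_zero {k : ℕ} {X Y : RibbonGraph k} (h : IsEmpty (RibbonIso X Y)) :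
    charFun X Y = 0 := by
  rw [charFun, if_neg fun ⟨φ, _⟩ => h.elim φ, if_neg fun ⟨φ, _⟩ => h.elim φ, sub_zero]

section FourValent

variable {k : ℕ} {Y : RibbonGraph k} (e : Fin k × Fin 4 ≃ Y.H)

/-- The isomorphism from the polygon graph to a graph with half-edges `Fin k × Fin 4` that is given
by `placed s r`. -/
def placedIso (he : ∀ i a, e (i, a + 1) = Y.rot (e (i, a))) (hv : ∀ i a, Y.vert (e (i, a)) = i)
    (s : Perm (Fin k)) (r : Fin k → Fin 4)
    (h : ∀ x, e (placed s r (polygonFlip x)) = Y.flip (e (placed s r x))) :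
    RibbonIso (polygonGraph k) Y where
  toEquiv := (placed s r).trans e
  map_rot x := by
    obtain ⟨i, a⟩ := x
    refine Eq.trans ?_ (he _ _)
    exact congrArg e (Prod.ext rfl (add_right_comm _ _ _))
  map_flip := h
  perm := s
  map_vert _ := hv _ _

/-- Compatibility with the cyclic orders leaves only a vertex permutation and a rotation at each
vertex; preserving edges is the remaining condition. This turns isomorphisms into the indices of the
sums in `cutForm`. -/
theorem placedIso_bijective (he : ∀ i a, e (i, a + 1) = Y.rot (e (i, a)))
    (hv : ∀ i a, Y.vert (e (i, a)) = i) :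
    Function.Bijective fun p : {p : Perm (Fin k) × (Fin k → Fin 4) //
      ∀ x, e (placed p.1 p.2 (polygonFlip x)) = Y.flip (e (placed p.1 p.2 x))} =>
        placedIso e he hv p.1.1 p.1.2 p.2 := by
  constructor
  · rintro ⟨⟨s, r⟩, h⟩ ⟨⟨s', r'⟩, h'⟩ heq
    have h1 : ∀ x, placed s r x = placed s' r' x := fun x => e.injective
      (congrArg (fun φ : RibbonIso (polygonGraph k) Y => φ.toEquiv x) heq)
    obtain ⟨rfl, rfl⟩ := placed_injective h1
    rfl
  · intro φ
    have hv' : ∀ y, (e.symm y).1 = Y.vert y := by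
      intro y
      obtain ⟨⟨i, a⟩, rfl⟩ := e.surjective y
      rw [Equiv.symm_apply_apply, hv]
    have he' : ∀ y, e.symm (Y.rot y) = ((e.symm y).1, (e.symm y).2 + 1) := by
      intro y
      obtain ⟨⟨i, a⟩, rfl⟩ := e.surjective y
      rw [← he, Equiv.symm_apply_apply, Equiv.symm_apply_apply]
    obtain ⟨r, hr⟩ := exists_placed (φ.toEquiv.trans e.symm) φ.perm
      (fun h => (hv' _).trans (φ.map_vert h))
      (fun i a => (congrArg e.symm (φ.map_rot (i, a))).trans (he' _))
    have h1 : ∀ x, e (placed φ.perm r x) = φ.toEquiv x := fun x =>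
      (congrArg e (Equiv.congr_fun hr x)).symm.trans (e.apply_symm_apply _)
    refine ⟨⟨(φ.perm, r), fun x => ?_⟩, RibbonIso.ext_toEquiv h1⟩
    rw [h1, h1]
    exact φ.map_flip x

/-- The sign recording whether a half-edge is initial. -/
def dirSign (b : Bool) : ℚ := if b then 1 else -1

theorem dirSign_mul_self (b : Bool) : dirSign b * dirSign b = 1 := by
  cases b <;> simp [dirSign]

-- The right-hand side is the sum of the signs of all isomorphisms from `X_k` to `Y`. These are
-- either absent or `2k` in number with one common sign.
open Classical in
theorem charFun_eq_sum_placed (hk : k % 4 = 1) (hk1 : k ≠ 1)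
    (he : ∀ i a, e (i, a + 1) = Y.rot (e (i, a))) (hv : ∀ i a, Y.vert (e (i, a)) = i) :
    2 * k * charFun (polygonGraph k) Y = ∑ p : Perm (Fin k) × (Fin k → Fin 4),
      if ∀ x, e (placed p.1 p.2 (polygonFlip x)) = Y.flip (e (placed p.1 p.2 x)) then
        ((Perm.sign p.1 : ℤ) : ℚ) * ∏ i, dirSign (Y.out (e (placed p.1 p.2 (i, 1)))) *
          dirSign (Y.out (e (placed p.1 p.2 (i, 2)))) else 0 := by
  have hb := placedIso_bijective e he hv
  have hsgn : ∀ (p : Perm (Fin k) × (Fin k → Fin 4)) h,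
      ((Perm.sign p.1 : ℤ) : ℚ) * ∏ i, dirSign (Y.out (e (placed p.1 p.2 (i, 1)))) *
      dirSign (Y.out (e (placed p.1 p.2 (i, 2)))) =
        (((placedIso e he hv p.1 p.2 h).sgn : ℤ) : ℚ) := by
    intro p h
    have h1 := prod_out_polygonGraph fun x =>
      if Y.out ((placedIso e he hv p.1 p.2 h).toEquiv x) then (1 : ℤˣ) else -1
    have h2 : ∀ b : Bool, (((if b = true then (1 : ℤˣ) else -1 : ℤˣ) : ℤ) : ℚ) = dirSign b := by
      intro b
      cases b <;> simp [dirSign]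
    have h3 : (placedIso e he hv p.1 p.2 h).sgn = Perm.sign p.1 *
      ∏ i, (if Y.out (e (placed p.1 p.2 (i, 1))) then (1 : ℤˣ) else -1) *
        (if Y.out (e (placed p.1 p.2 (i, 2))) then (1 : ℤˣ) else -1) :=
      congrArg (Perm.sign p.1 * ·) h1
    rw [h3]
    push_cast
    simp only [h2]
  rw [← Finset.sum_filter]
  rcases isEmpty_or_nonempty (RibbonIso (polygonGraph k) Y) with h0 | ⟨⟨φ⟩⟩
  · rw [charFun_eq_zero h0, mul_zero, Finset.sum_eq_zero]
    intro p hp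
    exact h0.elim (placedIso e he hv p.1 p.2 (Finset.mem_filter.1 hp).2)
  · have h1 : ∀ p ∈ univ.filter fun p : Perm (Fin k) × (Fin k → Fin 4) =>
        ∀ x, e (placed p.1 p.2 (polygonFlip x)) = Y.flip (e (placed p.1 p.2 x)),
        ((Perm.sign p.1 : ℤ) : ℚ) * ∏ i, dirSign (Y.out (e (placed p.1 p.2 (i, 1)))) *
          dirSign (Y.out (e (placed p.1 p.2 (i, 2)))) = charFun (polygonGraph k) Y := by
      intro p hp
      rw [hsgn p (Finset.mem_filter.1 hp).2, charFun_polygonGraph hk hk1]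
    -- One isomorphism `φ` identifies all the others with automorphisms of `X_k`.
    have h2 : RibbonIso (polygonGraph k) Y ≃ RibbonIso (polygonGraph k) (polygonGraph k) :=
      { toFun := fun ψ => ψ.trans φ.symm
        invFun := fun ψ => ψ.trans φ
        left_inv := fun ψ => RibbonIso.ext_toEquiv fun x => φ.toEquiv.apply_symm_apply _
        right_inv := fun ψ => RibbonIso.ext_toEquiv fun x => φ.toEquiv.symm_apply_apply _ }
    rw [Finset.sum_congr rfl h1, Finset.sum_const, nsmul_eq_mul]
    congr 1
    rw [← Fintype.card_subtype, ← Nat.card_eq_fintype_card, Nat.card_eq_of_bijective _ hb,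
      Nat.card_congr h2, card_polygonAut (by omega)]
    push_cast
    ring

end FourValent

/-- The fourth power of the vertex rotation is the identity on `X_k`, but not on a spider with `m ≥
3`, `m ≠ 4` legs. -/
theorem isEmpty_ribbonIso_glue {ι : Type} {k : ℕ} {w : Fin k → List (Letter ι)}
    (hw : ∀ j, 3 ≤ (w j).length) (p : Gluing (Leg w)) {j : Fin k} (hj : (w j).length ≠ 4) :
    IsEmpty (RibbonIso (polygonGraph k) (glue w hw p)) := by
  refine ⟨fun φ => ?_⟩
  have h4 : ∀ x : Fin k × Fin 4, polygonRot k (polygonRot k (polygonRot k (polygonRot k x))) = x := by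
    rintro ⟨i, a⟩
    simp only [polygonRot_apply]
    have : ∀ a : Fin 4, a + 1 + 1 + 1 + 1 = a := by decide
    rw [this]
  let E : Fin k × Fin 4 ≃ Leg w := φ.toEquiv
  have hr : ∀ x, E (polygonRot k x) = legRot w (E x) := φ.map_rot
  have h5 : ∀ y : Leg w, legRot w (legRot w (legRot w (legRot w y))) = y := by
    intro y
    obtain ⟨x, rfl⟩ := E.surjective y
    rw [← hr, ← hr, ← hr, ← hr, h4]
  have hfin : ∀ m : ℕ, 3 ≤ m → m ≠ 4 → ∃ a : Fin m,
      finRotate m (finRotate m (finRotate m (finRotate m a))) ≠ a := by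
    intro m hm hm4
    obtain ⟨n, rfl⟩ := Nat.exists_eq_add_of_le' hm
    refine ⟨0, fun h => ?_⟩
    have h' := congrArg Fin.val h
    simp only [finRotate_apply, Fin.val_add, Fin.val_zero, zero_add, Fin.val_one] at h'
    rcases n with _ | _ | n
    · simp at h'
    · exact hm4 rfl
    · simp [Nat.mod_eq_of_lt] at h'
  obtain ⟨a, ha⟩ := hfin _ (hw j) hj
  have h6 := h5 ⟨j, a⟩
  have h7 : (⟨j, finRotate _ (finRotate _ (finRotate _ (finRotate _ a)))⟩ : Leg w) = ⟨j, a⟩ := h6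
  exact ha (by simpa using h7)

/-! ### Gluings with a prescribed pairing -/

/-- Both products have one factor per edge. Where the directions `d` and `o` disagree, `F` changes
sign, as `dirSign` records. -/
theorem prod_directed {H : Type} [Fintype H] {f : H → H}
    (hf : ∀ h, f (f h) = h) {o d : H → Bool} (ho : ∀ h, o (f h) = !o h)
    (hd : ∀ h, d (f h) = !d h) (F : H → ℚ) (hF : ∀ h, F (f h) = - F h) :
    ∏ h with d h = true, F h = ∏ h with o h = true, dirSign (d h) * F h := by
  rw [← Finset.prod_filter_mul_prod_filter_not _ (fun h => o h = true),
    ← Finset.prod_filter_mul_prod_filter_not (univ.filter fun h => o h = true)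
      (fun h => d h = true), Finset.filter_filter, Finset.filter_filter, Finset.filter_filter,
      Finset.filter_filter]
  congr 1
  · refine Finset.prod_congr (Finset.filter_congr fun h _ => and_comm) fun h hh => ?_
    rw [(Finset.mem_filter.1 hh).2.2, dirSign, if_pos rfl, one_mul]
  · refine Finset.prod_nbij' f f ?_ ?_ ?_ ?_ ?_
    · intro h hh
      simp only [Finset.mem_filter, Finset.mem_univ, true_and] at hh ⊢
      simp [ho, hd, hh]
    · intro h hh
      simp only [Finset.mem_filter, Finset.mem_univ, true_and] at hh ⊢
      simp [ho, hd, hh]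
    · exact fun h _ => hf h
    · exact fun h _ => hf h
    · intro h hh
      simp only [Finset.mem_filter, Finset.mem_univ, true_and] at hh
      simp [hd, hh, hF, dirSign]

/-- The choice of directions for the edges of the polygon graph which are given by `f`: the first
component for the loop and the second one for the polygon edge that starts at a vertex. -/
def polygonDir {k : ℕ} (f : Fin k → Bool × Bool) : Fin k × Fin 4 → Bool
  | (i, 0) => !(f ((finRotate k).symm i)).2
  | (i, 1) => (f i).1
  | (i, 2) => (f i).2
  | (i, 3) => !(f i).1

theorem polygonDir_flip {k : ℕ} (f : Fin k → Bool × Bool) (h : Fin k × Fin 4) :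
    polygonDir f (polygonFlip h) = !polygonDir f h := by
  obtain ⟨i, a⟩ := h
  fin_cases a
  · simp [polygonDir, polygonFlip]
  · rfl
  · exact congrArg (fun j => !(f j).2) ((finRotate k).symm_apply_apply i)
  · exact (Bool.not_not _).symm

-- The pairing is prescribed, and the direction of each of the `2k` edges is free.
open Classical in
theorem card_gluing_polygonFlip {k : ℕ} {L : Type} [Fintype L] [DecidableEq L]
    (ψ : Fin k × Fin 4 ≃ L) :
    (univ.filter fun p : Gluing L => ∀ x, ψ (polygonFlip x) = p.1.1 (ψ x)).card = 4 ^ k := by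
  have hc : Fintype.card (Fin k → Bool × Bool) = 4 ^ k := by simp
  rw [← hc, ← Finset.card_univ]
  symm
  let P : Perm (Fin k × Fin 4) := ⟨polygonFlip, polygonFlip, polygonFlip_flip, polygonFlip_flip⟩
  refine Finset.card_bij' (fun f _ => ⟨(ψ.permCongr P, fun g => polygonDir f (ψ.symm g)), ?_, ?_⟩)
    (fun p _ => fun i => (p.1.2 (ψ (i, 1)), p.1.2 (ψ (i, 2)))) ?_ ?_ ?_ ?_
  · intro g
    simp [Equiv.permCongr_apply, P, polygonFlip_flip]
  · intro g
    simp [Equiv.permCongr_apply, P, polygonDir_flip]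
  · intro f _
    simp [Equiv.permCongr_apply, P]
  · simp
  · intro f _
    simp [polygonDir]
  · intro p hp
    have h1 : ∀ x, ψ (polygonFlip x) = p.1.1 (ψ x) := (Finset.mem_filter.1 hp).2
    refine Subtype.ext (Prod.ext (Equiv.ext fun g => ?_) (funext fun g => ?_))
    · obtain ⟨x, rfl⟩ := ψ.surjective g
      simp [Equiv.permCongr_apply, P, h1]
    · obtain ⟨⟨i, a⟩, rfl⟩ := ψ.surjective g
      have h2 : ∀ x, p.1.2 (ψ (polygonFlip x)) = !p.1.2 (ψ x) := by
        intro x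
        rw [h1, p.2.2]
      fin_cases a
      · have := h2 (i, 0)
        simp [polygonDir, polygonFlip] at this ⊢
        simp [this]
      · simp [polygonDir]
      · simp [polygonDir]
      · have := h2 (i, 3)
        simp [polygonDir, polygonFlip] at this ⊢
        simp [this]

/-- The contraction of the labels along the polygon graph. -/
theorem prod_om_mul_prod_dirSign {ι : Type} [DecidableEq ι] {k : ℕ} {L : Type} [Fintype L]
    [DecidableEq L] (ψ : Fin k × Fin 4 ≃ L) (lab : L → Letter ι) (p : Gluing L)
    (hp : ∀ x, ψ (polygonFlip x) = p.1.1 (ψ x)) :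
    (∏ g with p.1.2 g = true, om (lab g) (lab (p.1.1 g))) *
      ∏ i, dirSign (p.1.2 (ψ (i, 1))) * dirSign (p.1.2 (ψ (i, 2))) =
    ∏ i, om (lab (ψ (i, 1))) (lab (ψ (i, 3))) *
      om (lab (ψ (i, 2))) (lab (ψ (finRotate k i, 0))) := by
  have h1 : ∏ g with p.1.2 g = true, om (lab g) (lab (p.1.1 g)) =
      ∏ x with p.1.2 (ψ x) = true, om (lab (ψ x)) (lab (ψ (polygonFlip x))) := by
    symm
    refine Finset.prod_equiv ψ (fun x => ?_) (fun x _ => ?_)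
    · simp
    · rw [hp]
  have h2 := prod_directed (f := polygonFlip (k := k)) polygonFlip_flip
    (o := (polygonGraph k).out) (polygonGraph k).out_flip (d := fun x => p.1.2 (ψ x))
    (fun x => by rw [hp, p.2.2]) (fun x => om (lab (ψ x)) (lab (ψ (polygonFlip x))))
    (fun x => by rw [polygonFlip_flip, om_symm])
  rw [h1, h2]
  have h3 := prod_out_polygonGraph fun x : Fin k × Fin 4 => dirSign (p.1.2 (ψ x)) *
    om (lab (ψ x)) (lab (ψ (polygonFlip x)))
  refine (congrArg (· * _) h3).trans ?_
  rw [← Finset.prod_mul_distrib]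
  refine Finset.prod_congr rfl fun i _ => ?_
  -- The signs from the contractions and from the orientation of the graph occur in pairs, so the
  -- chosen directions drop out.
  have h4 := dirSign_mul_self (p.1.2 (ψ (i, 1)))
  have h5 := dirSign_mul_self (p.1.2 (ψ (i, 2)))
  simp only [polygonFlip]
  calc _ = (dirSign (p.1.2 (ψ (i, 1))) * dirSign (p.1.2 (ψ (i, 1)))) *
        (dirSign (p.1.2 (ψ (i, 2))) * dirSign (p.1.2 (ψ (i, 2)))) *
        (om (lab (ψ (i, 1))) (lab (ψ (i, 3))) *
          om (lab (ψ (i, 2))) (lab (ψ (finRotate k i, 0)))) := by ring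
    _ = _ := by rw [h4, h5, one_mul, one_mul]

/-! ### Comparison of the two cochains -/

theorem Theta_mk {k : ℕ} (Y : RibbonGraph k) :
    Theta k (OG.mk Y) = charFun (polygonGraph k) Y := by
  rw [Theta, charMap, OG.mk, Submodule.liftQ_apply, Finsupp.linearCombination_single, one_smul]

theorem wordCut_rotate {ι : Type} [DecidableEq ι] {l : List (Letter ι)} (hl : l.length = 4)
    (r : Fin 4) : wordCut (l.rotate r) =
      om (l.get (Fin.cast hl.symm (1 + r))) (l.get (Fin.cast hl.symm (3 + r))) •
        Finsupp.single ![l.get (Fin.cast hl.symm (0 + r)), l.get (Fin.cast hl.symm (2 + r))] 1 := by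
  obtain ⟨a, b, c, d, rfl⟩ : ∃ a b c d, l = [a, b, c, d] := List.length_eq_four.1 hl
  fin_cases r <;> rfl

/-- The half-edges of `k` spiders with four legs each. -/
def legEquiv {ι : Type} {k : ℕ} {w : Fin k → List (Letter ι)} (hw : ∀ j, (w j).length = 4) :
    Fin k × Fin 4 ≃ Leg w :=
  (Equiv.sigmaEquivProd (Fin k) (Fin 4)).symm.trans
    (Equiv.sigmaCongrRight fun j => finCongr (hw j).symm)

theorem legRot_legEquiv {ι : Type} {k : ℕ} {w : Fin k → List (Letter ι)}
    (hw : ∀ j, (w j).length = 4) (i : Fin k) (a : Fin 4) :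
    legEquiv hw (i, a + 1) = legRot w (legEquiv hw (i, a)) := by
  have h : ∀ (m : ℕ) (hm : 4 = m), Fin.cast hm (a + 1) = finRotate m (Fin.cast hm a) := by
    rintro m rfl
    rw [finRotate_apply]
    rfl
  exact congrArg (Sigma.mk i) (h _ (hw i).symm)

/-- Double counting of pairs consisting of a gluing and an isomorphism from `X_k` to the glued
graph: fixing the gluing gives `2k` times `Θ_k`, while fixing the placement `(s, r)` gives a term of
`cutForm` at the words rotated by `r`. -/
theorem Theta_spiderGlue {ι : Type} [DecidableEq ι] {k : ℕ} (hk : k % 4 = 1) (hk1 : k ≠ 1)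
    {w : Fin k → List (Letter ι)} (hw : ∀ j, (w j).length = 4) :
    2 * k * Theta k (spiderGlue w) = ∑ r : Fin k → Fin 4,
      cutForm ι k fun j => Finsupp.single ((w j).rotate (r j)) 1 := by
  classical
  have hw3 : ∀ j, 3 ≤ (w j).length := fun j => by rw [hw j]; norm_num
  set e := legEquiv hw
  -- The contraction over loops and polygon edges for the placement `p`; it does not involve the
  -- gluing.
  let T : Perm (Fin k) × (Fin k → Fin 4) → ℚ := fun p =>
    ∏ i, om (label w (e (placed p.1 p.2 (i, 1)))) (label w (e (placed p.1 p.2 (i, 3)))) *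
      om (label w (e (placed p.1 p.2 (i, 2)))) (label w (e (placed p.1 p.2 (finRotate k i, 0))))
  have hcut : ∀ r : Fin k → Fin 4, (cutForm ι k fun j => Finsupp.single ((w j).rotate (r j)) 1) =
      ∑ s : Perm (Fin k), ((Perm.sign s : ℤ) : ℚ) * T (s, r) := by
    intro r
    rw [cutForm_apply]
    refine Finset.sum_congr rfl fun s _ => ?_
    rw [Units.smul_def, zsmul_eq_mul]
    congr 1
    simp only [cut_single, wordCut_rotate (hw _)]
    rw [MultilinearMap.map_smul_univ, polygonContr_single, smul_eq_mul, ← Finset.prod_mul_distrib]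
    rfl
  have hcard : Fintype.card (Leg w) / 2 = 2 * k := by
    rw [← Fintype.card_congr e, Fintype.card_prod, Fintype.card_fin, Fintype.card_fin]
    omega
  have hterm : ∀ g : Gluing (Leg w), 2 * k * Theta k (glueCoeff w g • OG.mk (glue w hw3 g)) =
      ∑ p : Perm (Fin k) × (Fin k → Fin 4),
        if ∀ x, (placed p.1 p.2).trans e (polygonFlip x) = g.1.1 ((placed p.1 p.2).trans e x) then
          ((Perm.sign p.1 : ℤ) : ℚ) * T p else 0 := by
    intro g
    rw [map_smul, Theta_mk, smul_eq_mul, mul_left_comm,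
      charFun_eq_sum_placed (Y := glue w hw3 g) e hk hk1 (legRot_legEquiv hw) (fun _ _ => rfl),
      Finset.mul_sum]
    refine Finset.sum_congr rfl fun p _ => ?_
    rw [mul_ite, mul_zero]
    refine if_ctx_congr Iff.rfl (fun h => ?_) fun _ => rfl
    rw [mul_left_comm]
    congr 1
    exact prod_om_mul_prod_dirSign ((placed p.1 p.2).trans e) (label w) g h
  rw [spiderGlue, dif_pos hw3, map_smul, map_sum, smul_eq_mul, mul_left_comm, Finset.mul_sum,
    Finset.sum_congr rfl fun g _ => hterm g, Finset.sum_comm, hcard]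
  simp only [← Finset.sum_filter, Finset.sum_const, card_gluing_polygonFlip, nsmul_eq_mul]
  rw [← Finset.mul_sum, ← mul_assoc]
  -- The normalisation of the gluing sum cancels the number of directed gluings belonging to one
  -- placement.
  have h4 : (1 / 2 : ℚ) ^ (2 * k) * ((4 ^ k : ℕ) : ℚ) = 1 := by
    rw [pow_mul]
    push_cast
    rw [← mul_pow]
    norm_num
  rw [h4, one_mul, Fintype.sum_prod_type, Finset.sum_comm]
  exact Finset.sum_congr rfl fun r _ => (hcut r).symm

theorem Theta_spiderGlue_eq_zero {ι : Type} [DecidableEq ι] {k : ℕ} {w : Fin k → List (Letter ι)}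
    {j : Fin k} (hj : (w j).length ≠ 4) : Theta k (spiderGlue w) = 0 := by
  rw [spiderGlue]
  split_ifs with hw
  · rw [map_smul, map_sum, Finset.sum_eq_zero, smul_zero]
    intro g _
    rw [map_smul, Theta_mk, charFun_eq_zero (isEmpty_ribbonIso_glue hw g hj), smul_zero]
  · exact map_zero _

theorem rotL_pow_single {ι : Type} (n : ℕ) (l : List (Letter ι)) :
    (rotL ι ^ n) (Finsupp.single l 1) = Finsupp.single (l.rotate n) 1 := by
  induction n with
  | zero => simp
  | succ n ih => rw [pow_succ', Module.End.mul_apply, ih, rotL_single, List.rotate_rotate]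

/-- The `(1 / 4) ^ k` is the passage from invariants to coinvariants in length four; if a word has
another length, both sides vanish. -/
theorem Theta_psiTens {ι : Type} [DecidableEq ι] {k : ℕ} (hk : k % 4 = 1) (hk1 : k ≠ 1)
    (x : Fin k → Tens ι) : 2 * k * Theta k (psiTens ι k x) =
      (1 / 4) ^ k * ∑ r : Fin k → Fin 4, cutForm ι k fun j => (rotL ι ^ (r j : ℕ)) (x j) := by
  have h : (2 * k : ℚ) • (Theta k).compMultilinearMap (psiTens ι k) = ((1 / 4 : ℚ) ^ k) •
      ∑ r : Fin k → Fin 4, (cutForm ι k).toMultilinearMap.compLinearMap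
        fun j => rotL ι ^ (r j : ℕ) := by
    refine multilinear_ext_single fun w => ?_
    simp only [_root_.smul_apply, LinearMap.compMultilinearMap_apply, _root_.sum_apply,
      MultilinearMap.compLinearMap_apply, rotL_pow_single, AlternatingMap.coe_multilinearMap]
    rw [psiTens, mlin_single, map_smul, smul_eq_mul, smul_eq_mul, smul_eq_mul]
    by_cases hw : ∀ j, (w j).length = 4
    · rw [mul_left_comm, Theta_spiderGlue hk hk1 hw]
      simp [hw]
    · push Not at hw
      obtain ⟨j, hj⟩ := hw
      rw [Theta_spiderGlue_eq_zero hj, mul_zero, mul_zero, Finset.sum_eq_zero, mul_zero]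
      intro r _
      rw [cutForm_apply, Finset.sum_eq_zero]
      intro s _
      rw [MultilinearMap.map_coord_zero (i := s⁻¹ j), smul_zero]
      rw [← Perm.mul_apply, mul_inv_cancel, Perm.one_apply, cut_single,
        wordCut_of_length_ne (by simpa using hj)]
  have h1 := congrArg (fun f => f x) h
  simpa only [_root_.smul_apply, LinearMap.compMultilinearMap_apply, _root_.sum_apply,
    MultilinearMap.compLinearMap_apply, AlternatingMap.coe_multilinearMap, smul_eq_mul] using h1

/-- On cyclic invariants all `4 ^ k` rotated terms agree, which cancels `(1 / 4) ^ k`. -/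
theorem cutForm_eq_kontsevichCochain {k : ℕ} (hk : k % 4 = 1) (hk1 : k ≠ 1)
    (x : Fin k → aPlus ℕ) :
    cutForm ℕ k (fun j => (x j).1) = 2 * k * kontsevichCochain k x := by
  have h : kontsevichCochain k x = Theta k (psiTens ℕ k fun j => (x j).1) := rfl
  have hrot : ∀ (n : ℕ) (j : Fin k), (rotL ℕ ^ n) (x j).1 = (x j).1 := by
    intro n j
    induction n with
    | zero => rfl
    | succ n ih => rw [pow_succ', Module.End.mul_apply, ih, rotL_coe]
  rw [h, Theta_psiTens hk hk1]
  simp only [hrot, Finset.sum_const, Finset.card_univ, Fintype.card_fun, Fintype.card_fin,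
    nsmul_eq_mul]
  push_cast
  rw [← mul_assoc, ← mul_pow]
  norm_num

theorem moritaCochain_eq {k : ℕ} (hk : k % 4 = 1) (hk1 : k ≠ 1) :
    moritaCochain k = ((-1 : ℚ) * (k * 2 ^ (k + 1))) • kontsevichCochain k := by
  have hodd : Odd k := Nat.odd_iff.2 (by omega)
  refine AlternatingMap.ext fun x => ?_
  rw [moritaCochain_apply, cutForm_eq_kontsevichCochain hk hk1, AlternatingMap.smul_apply,
    smul_eq_mul, hodd.neg_pow]
  ring

/-- This direction carries the cocycle condition and membership in `PHsp` from Morita's cochain to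
the ribbon cochain. -/
theorem kontsevichCochain_eq {k : ℕ} (hk : k % 4 = 1) (hk1 : k ≠ 1) :
    kontsevichCochain k = ((-1 : ℚ) * (k * 2 ^ (k + 1)))⁻¹ • moritaCochain k := by
  have : (k : ℚ) ≠ 0 := Nat.cast_ne_zero.2 (by omega)
  rw [moritaCochain_eq hk hk1, smul_smul, inv_mul_cancel₀, one_smul]
  simp [this]

end Ribbon

end

/-! ### Transfer between the two cochains and passage to cohomology -/

theorem mainTheorem4 (k : ℕ) (hk : k % 4 = 1) (hk1 : k ≠ 1) :
    (∀ (n : ℕ) (x : Fin k → ⋀[ℚ]^2 (Ribbon.V (Fin n))),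
      Ribbon.xi k (fun i => Ribbon.bToInf n (Submodule.Quotient.mk (x i))) =
        Ribbon.polygonForm (Fin n) k x) ∧
    ∃ ε : ℚ, (ε = 1 ∨ ε = -1) ∧
      Ribbon.moritaCochain k = (ε * (k * 2 ^ (k + 1))) • Ribbon.kontsevichCochain k ∧
      ∃ (hM : Ribbon.moritaCochain k ∈ Ribbon.cocycles (Ribbon.aBracket ℕ) k)
        (hK : Ribbon.kontsevichCochain k ∈ Ribbon.cocycles (Ribbon.aBracket ℕ) k),
        Ribbon.Coh.mk (Ribbon.aBracket ℕ) k ⟨Ribbon.moritaCochain k, hM⟩ ∈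
          Ribbon.PHsp k (2 * k) ∧
        Ribbon.Coh.mk (Ribbon.aBracket ℕ) k ⟨Ribbon.kontsevichCochain k, hK⟩ ∈
          Ribbon.PHsp k (2 * k) ∧
        Ribbon.Coh.mk (Ribbon.aBracket ℕ) k ⟨Ribbon.moritaCochain k, hM⟩ =
          (ε * (k * 2 ^ (k + 1))) •
            Ribbon.Coh.mk (Ribbon.aBracket ℕ) k ⟨Ribbon.kontsevichCochain k, hK⟩ := by
  have hM := Ribbon.moritaCochain_mem_cocycles k
  have hK : Ribbon.kontsevichCochain k ∈ Ribbon.cocycles (Ribbon.aBracket ℕ) k := by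
    rw [Ribbon.kontsevichCochain_eq hk hk1]
    exact Submodule.smul_mem _ _ hM
  have hP := Ribbon.mk_moritaCochain_mem_PHsp (k := k) (by omega)
  refine ⟨fun n x => Ribbon.xi_bToInf (Nat.odd_iff.2 (by omega)) hk1 n x, -1, .inr rfl,
    Ribbon.moritaCochain_eq hk hk1, hM, hK, hP, ?_, ?_⟩
  · have h : (⟨Ribbon.kontsevichCochain k, hK⟩ : Ribbon.cocycles (Ribbon.aBracket ℕ) k) =
        ((-1 : ℚ) * (k * 2 ^ (k + 1)))⁻¹ • ⟨Ribbon.moritaCochain k, hM⟩ :=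
      Subtype.ext (Ribbon.kontsevichCochain_eq hk hk1)
    rw [h, map_smul]
    exact Submodule.smul_mem _ _ hP
  · rw [← map_smul]
    exact congrArg _ (Subtype.ext (Ribbon.moritaCochain_eq hk hk1))
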